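/- Let $U$ and $V$ be separable real Banach spaces, let $(\Omega,\mathcal A,P)$ be a probability space with a filtration $(\mathcal F_t)_{t\ge 0}$, and let $T\ge 0$. An $\mathbb R^n$-valued Wiener process is an adapted process $B$ with $B(0)=0$ a.s., with independent increments, and with $B(t)-B(s)\sim N(0,(t-s)C)$ for $0\le s\le t$ and some symmetric non-negative definite matrix $C$. Let $W=(W(t))_{t\ge0}$ be a strongly cylindrical Wiener process in $U$ with covariance operator $Q$; that is, $W(t):U^*\to L^0(\Omega)$ is linear for each $t\ge 0$, $(W(t)u_1^*,\dots,W(t)u_n^*)_{t\ge 0}$ is an $\mathbb R^n$-valued Wiener process for all $n$ and all $u_1^*,\dots,u_n^*\in U^*$, and $Q:U^*\to U$ is a (bounded, positive, symmetric) operator with $\langle Qu^*,v^*\rangle=\operatorname{Cov}(W(1)u^*,W(1)v^*)$ for all $u^*,v^*\in U^*$. Let $H=H_Q$ be the reproducing kernel Hilbert space of $Q$, i.e. the completion of the range of $Q$ for the inner product $[Qu^*,Qv^*]=\langle Qu^*,v^*\rangle$, and let $i_Q:H\to U$ be the continuous extension of the inclusion of the range of $Q$ in $U$, with adjoint $i_Q^*:U^*\to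 H$ (where $H^*$ is identified with $H$). Let $\Phi:[0,T]\to L(U,V)$ be a non-random integrand: for every $v^*\in V^*$ the map $s\mapsto\Phi^*(s)v^*\in U^*$ is Borel measurable and $\int_0^T\|\Phi^*(s)v^*\|_{U^*}^2\,ds<\infty$. For an orthonormal basis $(e_k)$ of $H$ and $u_k^*\in U^*$ with $i_Q^*u_k^*=e_k$, put $B_k(t)=W(t)u_k^*$. The cylindrical integral $\int_0^T\Phi\,dW:V^*\to L^2(\Omega)$ is $$\Big(\int_0^T\Phi(s)\,dW(s)\Big)v^*=\sum_{k}\int_0^T\langle\Phi(s)i_Qe_k,v^*\rangle\,dB_k(s)\quad\text{in }L^2(\Omega),\qquad v^*\in V^*,$$ where the integrals on the right are real-valued Itô integrals. Then, for every such choice of $(e_k)$ and $(u_k^*)$, the following are equivalent: (a) $\int_0^T\Phi(s)\,dW(s)$ is induced by a $V$-valued random variable, i.e. there is a measurable $Z:\Omega\to V$ such that for every $v^*\in V^*$ one has $\big(\int_0^T\Phi(s)\,dW(s)\big)v^*=\langle Z,v^*\rangle$ $P$-a.s.; (b) there is a Gaussian measure $\mu$ on $V$ with covariance operator $R:V^*\to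 V$, $\langle Rv^*,w^*\rangle=\operatorname{Cov}_\mu(\langle\cdot,v^*\rangle,\langle\cdot,w^*\rangle)$, such that $$\int_0^T\|i_Q^*\Phi^*(s)v^*\|_H^2\,ds=\langle Rv^*,v^*\rangle\qquad\text{for all }v^*\in V^*.$$ -/

import Mathlib

open MeasureTheory ProbabilityTheory Filter Topology
open scoped NNReal ENNReal

noncomputable section

/-! ### Positive symmetric operators and their reproducing kernel Hilbert spaces -/

/-- A bounded linear operator `Q : U* → U` which is positive and symmetric. -/
structure PosSymmOperator (U : Type*) [NormedAddCommGroup U] [NormedSpace ℝ U] where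
  toCLM : StrongDual ℝ U →L[ℝ] U
  nonneg : ∀ u : StrongDual ℝ U, 0 ≤ u (toCLM u)
  symm : ∀ u v : StrongDual ℝ U, v (toCLM u) = u (toCLM v)

namespace PosSymmOperator

variable {U : Type*} [NormedAddCommGroup U] [NormedSpace ℝ U] (Q : PosSymmOperator U)

/-- The range of `Q` as a vector space. It is a separate type because it carries the norm of the
bracket `[Qu, Qv] = ⟨Qu, v⟩` and not the norm of `U`. -/
def PreRKHS : Type _ := LinearMap.range (Q.toCLM : StrongDual ℝ U →ₗ[ℝ] U)

instance : AddCommGroup Q.PreRKHS :=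
  inferInstanceAs (AddCommGroup (LinearMap.range (Q.toCLM : StrongDual ℝ U →ₗ[ℝ] U)))

instance : Module ℝ Q.PreRKHS :=
  inferInstanceAs (Module ℝ (LinearMap.range (Q.toCLM : StrongDual ℝ U →ₗ[ℝ] U)))

/-- The inclusion of the range of `Q` into `U`. -/
def preIncl : Q.PreRKHS →ₗ[ℝ] U :=
  (LinearMap.range (Q.toCLM : StrongDual ℝ U →ₗ[ℝ] U)).subtype

/-- The element `Qu` of the range of `Q`. -/
def mkRange (u : StrongDual ℝ U) : Q.PreRKHS := ⟨Q.toCLM u, u, rfl⟩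

theorem preIncl_mkRange (u : StrongDual ℝ U) : Q.preIncl (Q.mkRange u) = Q.toCLM u := rfl

theorem preIncl_injective : Function.Injective Q.preIncl := Subtype.val_injective

theorem exists_mkRange (x : Q.PreRKHS) : ∃ u, Q.mkRange u = x := by
  obtain ⟨u, hu⟩ := x.2
  exact ⟨u, Subtype.ext hu⟩

/-- Some `u ∈ U*` with `Qu = x`. -/
def preimage (x : Q.PreRKHS) : StrongDual ℝ U := (Q.exists_mkRange x).choose

theorem apply_preimage (x : Q.PreRKHS) : Q.toCLM (Q.preimage x) = Q.preIncl x := by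
  have h := (Q.exists_mkRange x).choose_spec
  exact congrArg Q.preIncl h

theorem apply_eq (x y : Q.PreRKHS) :
    Q.preimage y (Q.preIncl x) = Q.preimage x (Q.preIncl y) := by
  rw [← Q.apply_preimage x, ← Q.apply_preimage y, Q.symm]

theorem apply_sq_le (u v : StrongDual ℝ U) :
    v (Q.toCLM u) ^ 2 ≤ u (Q.toCLM u) * v (Q.toCLM v) := by
  have h : ∀ t : ℝ, 0 ≤ v (Q.toCLM v) * (t * t) + 2 * v (Q.toCLM u) * t + u (Q.toCLM u) := by
    intro t
    have h1 := Q.nonneg (u + t • v)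
    have h2 := Q.symm u v
    simp only [map_add, map_smul, _root_.add_apply, _root_.smul_apply,
      smul_eq_mul] at h1
    rw [← h2] at h1
    linarith
  have h3 := discrim_le_zero h
  rw [discrim] at h3
  nlinarith

/-- The inner product `[Qu, Qv] = ⟨Qu, v⟩` on the range of `Q`. -/
instance preCore : InnerProductSpace.Core ℝ Q.PreRKHS where
  inner x y := Q.preimage y (Q.preIncl x)
  conj_inner_symm x y := by
    simpa using Q.apply_eq y x
  re_inner_nonneg x := by
    rw [← Q.apply_preimage x]
    exact Q.nonneg _
  add_left x y z := by simp
  smul_left x y r := by simp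
  definite x h := by
    apply Q.preIncl_injective
    rw [map_zero]
    refine (SeparatingDual.eq_zero_iff_forall_dual_eq_zero (R := ℝ) _).2 fun v => ?_
    have h1 := Q.apply_sq_le (Q.preimage x) v
    rw [Q.apply_preimage x] at h1
    have h2 : Q.preimage x (Q.preIncl x) = 0 := h
    rw [h2, zero_mul] at h1
    exact pow_eq_zero_iff (two_ne_zero) |>.1 (le_antisymm h1 (sq_nonneg _))

instance : NormedAddCommGroup Q.PreRKHS := InnerProductSpace.Core.toNormedAddCommGroup (𝕜 := ℝ)

instance : InnerProductSpace ℝ Q.PreRKHS := InnerProductSpace.ofCore Q.preCore.toCore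

theorem inner_mkRange (u v : StrongDual ℝ U) :
    inner ℝ (Q.mkRange u) (Q.mkRange v) = v (Q.toCLM u) := by
  change Q.preimage (Q.mkRange v) (Q.preIncl (Q.mkRange u)) = _
  rw [Q.preIncl_mkRange, Q.symm, Q.apply_preimage, Q.preIncl_mkRange, Q.symm]

theorem norm_sq_eq (x : Q.PreRKHS) : ‖x‖ ^ 2 = Q.preimage x (Q.preIncl x) := by
  rw [← real_inner_self_eq_norm_sq]
  rfl

theorem norm_preIncl_le (x : Q.PreRKHS) : ‖Q.preIncl x‖ ≤ √‖Q.toCLM‖ * ‖x‖ := by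
  refine NormedSpace.norm_le_dual_bound ℝ _ (by positivity) fun v => ?_
  have h1 := Q.apply_sq_le (Q.preimage x) v
  rw [Q.apply_preimage, ← Q.norm_sq_eq] at h1
  have h2 : v (Q.toCLM v) ≤ ‖Q.toCLM‖ * ‖v‖ ^ 2 := by
    calc v (Q.toCLM v) ≤ ‖v‖ * ‖Q.toCLM v‖ := (le_abs_self _).trans (v.le_opNorm _)
      _ ≤ ‖v‖ * (‖Q.toCLM‖ * ‖v‖) := by gcongr; exact Q.toCLM.le_opNorm _
      _ = _ := by ring
  rw [Real.norm_eq_abs]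
  refine abs_le_of_sq_le_sq ?_ (by positivity)
  rw [mul_pow, mul_pow, Real.sq_sqrt (norm_nonneg Q.toCLM)]
  nlinarith [mul_le_mul_of_nonneg_left h2 (sq_nonneg ‖x‖)]

/-- The reproducing kernel Hilbert space `H_Q`: the completion of the range of `Q` with respect
to `[Qu, Qv] = ⟨Qu, v⟩`. -/
abbrev RKHS : Type _ := UniformSpace.Completion Q.PreRKHS

variable [CompleteSpace U]

/-- The inclusion `i_Q : H_Q → U`, the continuous extension of the inclusion of the range. -/
def incl : Q.RKHS →L[ℝ] U :=
  (Q.preIncl.mkContinuous (√‖Q.toCLM‖) Q.norm_preIncl_le).extend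
    (UniformSpace.Completion.toComplL (𝕜 := ℝ))

/-- The adjoint `i_Q* : U* → H_Q`, with `H_Q` identified with its dual. -/
def inclAdj (u : StrongDual ℝ U) : Q.RKHS :=
  (InnerProductSpace.toDual ℝ Q.RKHS).symm (u ∘L Q.incl)

theorem incl_coe (x : Q.PreRKHS) : Q.incl (x : Q.RKHS) = Q.preIncl x :=
  ContinuousLinearMap.extend_eq _ (UniformSpace.Completion.denseRange_coe)
    (UniformSpace.Completion.isUniformInducing_coe _) x

theorem inner_inclAdj (u : StrongDual ℝ U) (h : Q.RKHS) :
    inner ℝ (Q.inclAdj u) h = u (Q.incl h) := by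
  simp [inclAdj]

theorem inclAdj_eq (u : StrongDual ℝ U) : Q.inclAdj u = (Q.mkRange u : Q.RKHS) := by
  refine ext_inner_right ℝ fun h => ?_
  induction h using UniformSpace.Completion.induction_on with
  | hp => exact isClosed_eq (by fun_prop) (by fun_prop)
  | ih x =>
    obtain ⟨v, rfl⟩ := Q.exists_mkRange x
    rw [Q.inner_inclAdj, Q.incl_coe, UniformSpace.Completion.inner_coe, Q.inner_mkRange,
      Q.preIncl_mkRange, Q.symm]

/-- The factorization `Q = i_Q i_Q*`. -/
theorem incl_inclAdj (u : StrongDual ℝ U) : Q.incl (Q.inclAdj u) = Q.toCLM u := by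
  rw [Q.inclAdj_eq, Q.incl_coe, Q.preIncl_mkRange]

theorem incl_eq_zero {h : Q.RKHS} (hh : Q.incl h = 0) : h = 0 := by
  have key : ∀ g : Q.RKHS, inner ℝ h g = 0 := by
    intro g
    induction g using UniformSpace.Completion.induction_on with
    | hp => exact isClosed_eq (by fun_prop) (by fun_prop)
    | ih x =>
      obtain ⟨v, rfl⟩ := Q.exists_mkRange x
      rw [← Q.inclAdj_eq, real_inner_comm, Q.inner_inclAdj, hh, map_zero]
  exact inner_self_eq_zero.1 (key h)

/-- The data used to represent a cylindrical Wiener process with covariance operator `Q` as a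
series: an orthonormal basis `(e_k)` of `H_Q` and functionals `u_k ∈ U*` with `i_Q* u_k = e_k`. -/
structure Representation (ι : Type*) where
  basis : HilbertBasis ι ℝ Q.RKHS
  dual : ι → StrongDual ℝ U
  inclAdj_dual : ∀ k, Q.inclAdj (dual k) = basis k

/-- Such data exist if `U` is separable. -/
theorem exists_representation [TopologicalSpace.SeparableSpace U] :
    ∃ s : Set ℕ, Nonempty (Q.Representation s) := by
  let x := TopologicalSpace.denseSeq U
  choose d hd1 hd2 using fun n => exists_dual_vector'' ℝ (x n)
  have hsep : ∀ y : U, (∀ n, d n y = 0) → y = 0 := by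
    intro y hy
    by_contra hne
    have hpos : 0 < ‖y‖ / 2 := by have := norm_pos_iff.2 hne; positivity
    obtain ⟨n, hn⟩ := (TopologicalSpace.denseRange_denseSeq U).exists_dist_lt y hpos
    have h1 : ‖x n‖ ≤ ‖x n - y‖ := by
      have h2 : d n (x n - y) = ‖x n‖ := by rw [map_sub, hy n, sub_zero]; exact hd2 n
      rw [← h2]
      calc d n (x n - y) ≤ ‖d n‖ * ‖x n - y‖ := (le_abs_self _).trans ((d n).le_opNorm _)
        _ ≤ 1 * ‖x n - y‖ := by gcongr; exact hd1 n
        _ = _ := one_mul _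
    rw [dist_eq_norm, norm_sub_rev] at hn
    have h3 : ‖y‖ ≤ ‖x n‖ + ‖x n - y‖ := by
      have := norm_sub_le (x n) (x n - y)
      simpa using this
    linarith
  let f : ℕ → Q.RKHS := fun n => Q.inclAdj (d n)
  let g := InnerProductSpace.gramSchmidtNormed ℝ f
  have hadd : ∀ u v, Q.inclAdj (u + v) = Q.inclAdj u + Q.inclAdj v := fun u v => by
    refine ext_inner_right ℝ fun h => ?_
    simp [inner_add_left, inner_inclAdj]
  have hsmul : ∀ (c : ℝ) u, Q.inclAdj (c • u) = c • Q.inclAdj u := fun c u => by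
    refine ext_inner_right ℝ fun h => ?_
    simp [inner_smul_left, inner_inclAdj]
  let A : StrongDual ℝ U →ₗ[ℝ] Q.RKHS := ⟨⟨Q.inclAdj, hadd⟩, hsmul⟩
  have hspan : Submodule.span ℝ (Set.range g) = Submodule.span ℝ (Set.range f) :=
    (InnerProductSpace.span_gramSchmidtNormed_range (𝕜 := ℝ) f).trans
      (InnerProductSpace.span_gramSchmidt ℝ f)
  have hg : ∀ n, ∃ u, Q.inclAdj u = g n := fun n => by
    have h1 : g n ∈ Submodule.span ℝ (Set.range f) := hspan ▸ Submodule.subset_span ⟨n, rfl⟩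
    have h2 : Submodule.span ℝ (Set.range f) ≤ LinearMap.range A :=
      Submodule.span_le.2 (by rintro _ ⟨n, rfl⟩; exact ⟨d n, rfl⟩)
    exact h2 h1
  choose u hu using hg
  have ho := InnerProductSpace.gramSchmidtNormed_orthonormal' (𝕜 := ℝ) f
  refine ⟨_, ⟨HilbertBasis.mkOfOrthogonalEqBot ho ?_, fun k => u k, fun k => ?_⟩⟩
  · refine (Submodule.eq_bot_iff _).2 fun h hh => Q.incl_eq_zero (hsep _ fun n => ?_)
    have h1 : Submodule.span ℝ (Set.range f) ≤ (Submodule.span ℝ {h})ᗮ := by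
      rw [← hspan, Submodule.span_le]
      rintro _ ⟨m, rfl⟩
      rw [SetLike.mem_coe, Submodule.mem_orthogonal_singleton_iff_inner_right]
      by_cases hm : g m = 0
      · rw [hm, inner_zero_right]
      · rw [real_inner_comm]
        exact (Submodule.mem_orthogonal _ _).1 hh _ (Submodule.subset_span ⟨⟨m, hm⟩, rfl⟩)
    have h2 := h1 (Submodule.subset_span ⟨n, rfl⟩)
    rw [Submodule.mem_orthogonal_singleton_iff_inner_right, real_inner_comm] at h2
    rw [← Q.inner_inclAdj]
    exact h2
  · rw [hu]
    simp [g]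

end PosSymmOperator

/-! ### Wiener processes and cylindrical Wiener processes -/

section Wiener

variable {Ω : Type*} {mΩ : MeasurableSpace Ω}

/-- An `ℝⁿ`-valued Wiener process with covariance matrix `C`: it is adapted, starts at `0`, has
independent increments, and `B t - B s` has the law `N(0, (t - s) C)`. -/
structure IsWienerProcess (P : Measure Ω) (𝓕 : Filtration ℝ≥0 mΩ) {n : ℕ}
    (C : Matrix (Fin n) (Fin n) ℝ) (B : ℝ≥0 → Ω → EuclideanSpace ℝ (Fin n)) : Prop where
  posSemidef : C.PosSemidef
  adapted : ∀ t, AEStronglyMeasurable[𝓕 t] (B t) P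
  zero : B 0 =ᵐ[P] 0
  indep : HasIndepIncrements B P
  law : ∀ s t : ℝ≥0, s ≤ t →
    HasLaw (fun ω => B t ω - B s ω) (multivariateGaussian 0 (((t : ℝ) - s) • C)) P

/-- A cylindrical process `W(t) : U* → L⁰(Ω)` is a weakly cylindrical Wiener process if
`(W(t)u₁, …, W(t)uₙ)` is an `ℝⁿ`-valued Wiener process for all `u₁, …, uₙ ∈ U*`. -/
def IsWeaklyCylindricalWiener {U : Type*} [NormedAddCommGroup U] [NormedSpace ℝ U]
    (P : Measure Ω) (𝓕 : Filtration ℝ≥0 mΩ)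
    (W : ℝ≥0 → StrongDual ℝ U →ₗ[ℝ] (Ω →ₘ[P] ℝ)) : Prop :=
  ∀ (n : ℕ) (u : Fin n → StrongDual ℝ U), ∃ C : Matrix (Fin n) (Fin n) ℝ,
    IsWienerProcess P 𝓕 C (fun t ω => WithLp.toLp 2 (fun i => W t (u i) ω))

/-- `W` is a strongly cylindrical Wiener process and `Q` is the (`U`-valued) covariance operator of
the cylindrical distribution of `W(1)`. A `U`-valued covariance operator is automatically linear,
bounded, positive and symmetric. -/
structure IsStronglyCylindricalWiener {U : Type*} [NormedAddCommGroup U] [NormedSpace ℝ U]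
    (P : Measure Ω) (𝓕 : Filtration ℝ≥0 mΩ)
    (W : ℝ≥0 → StrongDual ℝ U →ₗ[ℝ] (Ω →ₘ[P] ℝ)) (Q : PosSymmOperator U) : Prop where
  weakly : IsWeaklyCylindricalWiener P 𝓕 W
  covariance_eq : ∀ u v : StrongDual ℝ U, v (Q.toCLM u) = cov[⇑(W 1 u), ⇑(W 1 v); P]

/-! ### The real-valued Itô integral -/

/-- A standard real Wiener process with respect to the filtration `𝓖`. -/
structure IsStandardWiener (P : Measure Ω) (𝓖 : Filtration ℝ≥0 mΩ)
    (B : ℝ≥0 → Ω →ₘ[P] ℝ) : Prop where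
  adapted : ∀ t, AEStronglyMeasurable[𝓖 t] (B t) P
  zero : B 0 = 0
  indep : ∀ s t : ℝ≥0, s ≤ t →
    Indep (𝓖 s) (MeasurableSpace.comap (fun ω => B t ω - B s ω) inferInstance) P
  law : ∀ s t : ℝ≥0, s ≤ t → HasLaw (fun ω => B t ω - B s ω) (gaussianReal 0 (t - s)) P

/-- A simple `𝓖`-adapted process on `[0, T]`, `∑ ξᵢ 1_{(tᵢ, tᵢ₊₁]}`, where `ξᵢ` is bounded and
`𝓖 tᵢ`-measurable. -/
structure SimpleProcess (𝓖 : Filtration ℝ≥0 mΩ) (T : ℝ≥0) where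
  n : ℕ
  time : Fin (n + 1) → ℝ≥0
  mono : Monotone time
  time_le : ∀ i, time i ≤ T
  coeff : Fin n → Ω → ℝ
  measurable_coeff : ∀ i : Fin n, Measurable[𝓖 (time i.castSucc)] (coeff i)
  bounded_coeff : ∀ i, ∃ K, ∀ ω, |coeff i ω| ≤ K

namespace SimpleProcess

variable {𝓖 : Filtration ℝ≥0 mΩ} {T : ℝ≥0} (φ : SimpleProcess 𝓖 T)

/-- The value of the process at time `s`. -/
def eval (s : ℝ) (ω : Ω) : ℝ :=
  ∑ i : Fin φ.n, (Set.Ioc (φ.time i.castSucc : ℝ) (φ.time i.succ)).indicator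
    (fun _ => φ.coeff i ω) s

/-- The elementary integral `∑ ξᵢ (B(tᵢ₊₁) - B(tᵢ))`. -/
def integral (B : ℝ≥0 → Ω → ℝ) (ω : Ω) : ℝ :=
  ∑ i : Fin φ.n, φ.coeff i ω * (B (φ.time i.succ) ω - B (φ.time i.castSucc) ω)

end SimpleProcess

/-- `X = ∫₀ᵀ f dB` in the sense of Itô: for a filtration with respect to which `B` is a standard
Wiener process, there are simple adapted processes that converge to `f` in `L²([0,T] × Ω)` and
whose elementary integrals converge to `X` in `L²(Ω)`. -/
def IsItoIntegral (P : Measure Ω) (B : ℝ≥0 → Ω →ₘ[P] ℝ) (T : ℝ≥0) (f : ℝ → Ω → ℝ)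
    (X : Lp ℝ 2 P) : Prop :=
  ∃ 𝓖 : Filtration ℝ≥0 mΩ, IsStandardWiener P 𝓖 B ∧ ∃ φ : ℕ → SimpleProcess 𝓖 T,
    Tendsto (fun n => ∫⁻ s in Set.Icc (0 : ℝ) T, ∫⁻ ω, ‖f s ω - (φ n).eval s ω‖ₑ ^ 2 ∂P)
      atTop (𝓝 0) ∧
    Tendsto (fun n => eLpNorm (fun ω => (φ n).integral (fun t => ⇑(B t)) ω - X ω) 2 P)
      atTop (𝓝 0)

open Classical in
/-- The Itô integral `∫₀ᵀ f dB` as an element of `L²(Ω)`. -/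
def itoIntegral (P : Measure Ω) (B : ℝ≥0 → Ω →ₘ[P] ℝ) (T : ℝ≥0) (f : ℝ → Ω → ℝ) : Lp ℝ 2 P :=
  if h : ∃ X, IsItoIntegral P B T f X then h.choose else 0

/-! ### The cylindrical stochastic integral -/

variable {U V : Type*} [NormedAddCommGroup U] [NormedSpace ℝ U]
  [NormedAddCommGroup V] [NormedSpace ℝ V]

/-- The set `M_T(U, V)` of admissible integrands; `v ∘L Φ s ω` is `Φ*(s, ω) v`. -/
structure IsIntegrand (P : Measure Ω) (𝓕 : Filtration ℝ≥0 mΩ) (T : ℝ≥0)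
    (Φ : ℝ → Ω → U →L[ℝ] V) : Prop where
  measurable : ∀ v : StrongDual ℝ V, Measurable[inferInstance, borel (StrongDual ℝ U)]
    (fun p : Set.Icc (0 : ℝ) T × Ω => v ∘L Φ p.1 p.2)
  adapted : ∀ (v : StrongDual ℝ V) (t : ℝ≥0), t ≤ T →
    Measurable[𝓕 t, borel (StrongDual ℝ U)] (fun ω => v ∘L Φ t ω)
  lintegral_lt_top : ∀ v : StrongDual ℝ V,
    ∫⁻ s in Set.Icc (0 : ℝ) T, ∫⁻ ω, ‖v ∘L Φ s ω‖ₑ ^ 2 ∂P < ∞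

/-- The cylindrical integral
`(∫₀ᵀ Φ dW) v = ∑ₖ ∫₀ᵀ ⟨Φ(s) i_Q eₖ, v⟩ dBₖ(s)` in `L²(Ω)`, where `Bₖ(t) = W(t) uₖ`. -/
def cylindricalIntegral [CompleteSpace U] (P : Measure Ω)
    (W : ℝ≥0 → StrongDual ℝ U →ₗ[ℝ] (Ω →ₘ[P] ℝ)) {Q : PosSymmOperator U} {ι : Type*}
    (r : Q.Representation ι) (T : ℝ≥0) (Φ : ℝ → Ω → U →L[ℝ] V) (v : StrongDual ℝ V) : Lp ℝ 2 P :=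
  ∑' k, itoIntegral P (fun t => W t (r.dual k)) T (fun s ω => v (Φ s ω (Q.incl (r.basis k))))

/-- A map `X : V* → L⁰(Ω)` is induced by the random variable `Z : Ω → V`. -/
def IsInducedBy (P : Measure Ω) (X : StrongDual ℝ V → Ω →ₘ[P] ℝ) (Z : Ω → V) : Prop :=
  ∀ v : StrongDual ℝ V, X v =ᵐ[P] fun ω => v (Z ω)

/-- `R : V* → V` is the covariance operator of the measure `μ` on `V`. -/
def IsCovarianceOperator [MeasurableSpace V] (μ : Measure V) (R : StrongDual ℝ V →L[ℝ] V) : Prop :=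
  ∀ v w : StrongDual ℝ V, w (R v) = cov[⇑v, ⇑w; μ]

end Wiener

end

/-! Write `X v` for the cylindrical integral at `v`. The proof separates what stochastic integration
says about `X` from a statement about linear maps `V* → L²(Ω)` with centred Gaussian values.

For the first half, each `B_k` is a standard Brownian motion, because `e_k` is a unit vector, and
different `B_k` are orthogonal in `L²`. For a nonrandom integrand the Itô integral is the Wiener
integral, an isometry on `L²([0, T])` (`itoIntegral_eq_wienerIntegral`). Orthogonality and Parseval
in `H_Q` then give `‖X v‖² = ∫ ‖i_Q* Φ*(s) v‖² ds` (`norm_cylindricalIntegral_sq`), so (b) says that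
`‖X v‖² = ⟨R v, v⟩`. Moreover `X v` lies in the closed span of the jointly Gaussian family `W(t)u`,
hence is centred Gaussian with variance `‖X v‖²` (`hasLaw_cylindricalIntegral`).

The second half is `exists_isInducedBy_iff`. If `Z` induces `X`, the law of `Z` is the required
Gaussian measure. Conversely, after centring `μ`, each `X v` has the law of `v` under `μ`; by
linearity and Cramér–Wold this extends to joint laws along sequences. A separating sequence `d`
embeds `V` into `ℝ^ℕ` as a Borel set, the sequence `(X (d n))` almost surely lies in the image, and
pulling it back to `V` produces `Z` on the given probability space. -/

/-! ### Joint Gaussianity and covariance of a cylindrical Wiener process -/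

namespace IsStronglyCylindricalWiener

variable {Ω : Type*} {mΩ : MeasurableSpace Ω} {P : Measure Ω} {𝓕 : Filtration ℝ≥0 mΩ}
  {U : Type*} [NormedAddCommGroup U] [NormedSpace ℝ U]
  {W : ℝ≥0 → StrongDual ℝ U →ₗ[ℝ] (Ω →ₘ[P] ℝ)} {Q : PosSymmOperator U}

theorem _root_.IsWienerProcess.hasLaw {n : ℕ} {C : Matrix (Fin n) (Fin n) ℝ}
    {B : ℝ≥0 → Ω → EuclideanSpace ℝ (Fin n)} (hB : IsWienerProcess P 𝓕 C B) (t : ℝ≥0) :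
    HasLaw (B t) (multivariateGaussian 0 ((t : ℝ) • C)) P := by
  have h := hB.law 0 t zero_le
  simp only [NNReal.coe_zero, sub_zero] at h
  refine h.congr ?_
  filter_upwards [hB.zero] with ω hω
  simp [hω]

theorem _root_.IsWienerProcess.isGaussianProcess {n : ℕ} {C : Matrix (Fin n) (Fin n) ℝ}
    {B : ℝ≥0 → Ω → EuclideanSpace ℝ (Fin n)} (hB : IsWienerProcess P 𝓕 C B) :
    IsGaussianProcess B P :=
  hB.indep.isGaussianProcess (fun t => (hB.hasLaw t).hasGaussianLaw) hB.zero

/-- Finitely many pairs `(t, u)` involve finitely many functionals. Applying the weak property to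
all of them at once makes each `W(t)u` a coordinate of a single vector-valued Wiener process, which
is Gaussian in time. -/
theorem isGaussianProcess (hW : IsStronglyCylindricalWiener P 𝓕 W Q) :
    IsGaussianProcess (fun (p : ℝ≥0 × StrongDual ℝ U) ω => W p.1 p.2 ω) P where
  hasGaussianLaw I := by
    obtain ⟨C, hC⟩ := hW.weakly I.card (fun i => (I.equivFin.symm i).1.2)
    have h := hC.isGaussianProcess.of_isGaussianProcess
      (Y := fun (p : I) ω => W p.1.1 p.1.2 ω) fun p => ⟨{p.1.1},
        (EuclideanSpace.proj (I.equivFin p)).comp (ContinuousLinearMap.proj ⟨p.1.1, by simp⟩),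
        fun ω => by simp⟩
    refine (h.hasGaussianLaw Finset.univ).map (F := I → ℝ)
      (ContinuousLinearMap.pi fun p => ContinuousLinearMap.proj ⟨p, Finset.mem_univ p⟩)

theorem memLp (hW : IsStronglyCylindricalWiener P 𝓕 W Q) (t : ℝ≥0) (u : StrongDual ℝ U) :
    MemLp (W t u) 2 P :=
  (hW.isGaussianProcess.hasGaussianLaw_eval (t, u)).memLp_two

theorem integral_eq_zero (hW : IsStronglyCylindricalWiener P 𝓕 W Q) (t : ℝ≥0)
    (u : StrongDual ℝ U) : ∫ ω, W t u ω ∂P = 0 := by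
  obtain ⟨C, hC⟩ := hW.weakly 1 (fun _ => u)
  have h := (hC.hasLaw t).integral_comp (f := fun x => x 0)
    (Measurable.aestronglyMeasurable (by fun_prop))
  have h2 := (EuclideanSpace.proj (0 : Fin 1)).integral_comp_comm (𝕜 := ℝ)
    (IsGaussian.integrable_id
      (μ := multivariateGaussian (0 : EuclideanSpace ℝ (Fin 1)) ((t : ℝ) • C)))
  simp only [Function.comp_def] at h
  rw [h]
  simpa using h2

/-- For `s ≤ t` the increment after `s` is independent of `W(s)u` and drops out. What remains is `s`
times an entry of the covariance matrix, and time `1` identifies that entry with `Q`. -/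
theorem covariance_eq_min [IsProbabilityMeasure P]
    (hW : IsStronglyCylindricalWiener P 𝓕 W Q) (s t : ℝ≥0) (u w : StrongDual ℝ U) :
    cov[W s u, W t w; P] = min s t * w (Q.toCLM u) := by
  wlog hst : s ≤ t generalizing s t u w
  · rw [covariance_comm, this t s w u (le_of_not_ge hst), min_comm, Q.symm]
  obtain ⟨C, hC⟩ := hW.weakly 2 ![u, w]
  have key : ∀ r : ℝ≥0, cov[W r u, W r w; P] = r * C 0 1 := fun r => by
    have h := (hC.hasLaw r).covariance_fun_comp (f := fun x => x 0) (g := fun x => x 1)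
      (Measurable.aemeasurable (by fun_prop)) (Measurable.aemeasurable (by fun_prop))
    exact h.trans ((covariance_eval_multivariateGaussian (hC.posSemidef.smul r.2) 0 1).trans
      (by simp))
  have h1 : w (Q.toCLM u) = C 0 1 := by
    rw [hW.covariance_eq, key 1, NNReal.coe_one, one_mul]
  have h2 := hC.indep.indepFun_eval_sub zero_le hst hC.zero
  have h3 : IndepFun (W s u) (⇑(W t w) - ⇑(W s w)) P :=
    h2.comp (φ := fun x : EuclideanSpace ℝ (Fin 2) => x 0)
      (ψ := fun x : EuclideanSpace ℝ (Fin 2) => x 1) (by fun_prop) (by fun_prop)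
  have h4 : ⇑(W t w) = (⇑(W t w) - ⇑(W s w)) + ⇑(W s w) := (sub_add_cancel _ _).symm
  rw [h4, covariance_add_right (hW.memLp s u) ((hW.memLp t w).sub (hW.memLp s w)) (hW.memLp s w),
    h3.covariance_eq_zero (hW.memLp s u) ((hW.memLp t w).sub (hW.memLp s w)), key, h1,
    min_eq_left hst, zero_add]

theorem isPreBrownianReal [IsProbabilityMeasure P]
    (hW : IsStronglyCylindricalWiener P 𝓕 W Q) {u : StrongDual ℝ U}
    (hu : u (Q.toCLM u) = 1) : IsPreBrownianReal (fun t => ⇑(W t u)) P :=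
  (hW.isGaussianProcess.comp_right fun t => (t, u)).isPreBrownianReal_of_covariance
    (fun t => hW.integral_eq_zero t u) fun s t hst => by
      have := hW.covariance_eq_min s t u u
      rw [hu, min_eq_left hst, mul_one] at this
      exact this

end IsStronglyCylindricalWiener

/-- The natural filtration is used because `IsWienerProcess` gives independence between increments
only, not independence of later increments from `𝓕 s`. -/
theorem ProbabilityTheory.IsPreBrownianReal.isStandardWiener {Ω : Type*} {mΩ : MeasurableSpace Ω}
    {P : Measure Ω} {B : ℝ≥0 → Ω →ₘ[P] ℝ} (hB : IsPreBrownianReal (fun t => ⇑(B t)) P) :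
    IsStandardWiener P (Filtration.natural (fun t => ⇑(B t)) fun t => (B t).stronglyMeasurable)
      B where
  adapted t := ⟨_, Filtration.stronglyAdapted_natural (fun t => (B t).stronglyMeasurable) t, .rfl⟩
  zero := by
    ext
    filter_upwards [hB.eval_zero_ae_eq_zero, AEEqFun.coeFn_zero (β := ℝ) (μ := P)] with ω h1 h2
    rw [h1, h2]; rfl
  indep s t hst := by
    have h := hB.indepFun_shift s
    -- The increment is the coordinate `t - s` of the process restarted at time `s`.
    have h2 := h.symm.comp measurable_id
      (show Measurable fun x : ℝ≥0 → ℝ => x (t - s) from measurable_pi_apply _)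
    rw [IndepFun_iff_Indep] at h2
    convert h2 using 1
    · simp only [Filtration.natural, MeasurableSpace.pi, MeasurableSpace.comap_iSup,
        MeasurableSpace.comap_comp, iSup_subtype, Function.id_comp]
      rfl
    · congr 1
      ext ω
      simp [add_tsub_cancel_of_le hst]
  law s t hst := by
    have h := hB.hasLaw_sub t s
    have h2 : nndist (t : ℝ) s = t - s := by
      ext
      rw [coe_nndist, Real.dist_eq, abs_of_nonneg (sub_nonneg.2 (NNReal.coe_le_coe.2 hst)),
        NNReal.coe_sub hst]
    exact h2 ▸ h

/-! ### Moments of Wiener increments weighted by past variables -/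

namespace IsStandardWiener

variable {Ω : Type*} {mΩ : MeasurableSpace Ω} {P : Measure Ω} {𝓖 : Filtration ℝ≥0 mΩ}
  {B : ℝ≥0 → Ω →ₘ[P] ℝ} {a b c d s t : ℝ≥0} {ζ : Ω → ℝ}

theorem memLp_sub (hB : IsStandardWiener P 𝓖 B) (hst : s ≤ t) (p : ℝ≥0∞) (hp : p ≠ ∞) :
    MemLp (⇑(B t) - ⇑(B s)) p P :=
  (hB.law s t hst).hasGaussianLaw.memLp hp

theorem aestronglyMeasurable_sub (hB : IsStandardWiener P 𝓖 B) (hsa : s ≤ a) (hta : t ≤ a) :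
    AEStronglyMeasurable[𝓖 a] (⇑(B t) - ⇑(B s)) P :=
  ((hB.adapted t).mono (𝓖.mono hta)).sub ((hB.adapted s).mono (𝓖.mono hsa))

/-- Adaptedness holds only up to null sets, so `ζ` is first replaced by a `𝓖 s`-measurable version.
-/
theorem indepFun (hB : IsStandardWiener P 𝓖 B) (hst : s ≤ t)
    (hζ : AEStronglyMeasurable[𝓖 s] ζ P) : IndepFun ζ (⇑(B t) - ⇑(B s)) P := by
  refine IndepFun.congr ?_ hζ.ae_eq_mk.symm .rfl
  rw [IndepFun_iff_Indep]
  exact indep_of_indep_of_le_left (hB.indep s t hst) hζ.stronglyMeasurable_mk.measurable.comap_le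

theorem integral_mul_sub (hB : IsStandardWiener P 𝓖 B) (hst : s ≤ t)
    (hζ : AEStronglyMeasurable[𝓖 s] ζ P) : ∫ ω, (ζ * (⇑(B t) - ⇑(B s))) ω ∂P = 0 := by
  have h : ∫ ω, (⇑(B t) - ⇑(B s)) ω ∂P = 0 :=
    (hB.law s t hst).integral_eq.trans integral_id_gaussianReal
  rw [(hB.indepFun hst hζ).integral_mul_eq_mul_integral (hζ.mono (𝓖.le s))
    (hB.memLp_sub hst 2 (by simp)).1, h, mul_zero]

theorem integral_mul_sub_mul_sub_self [IsProbabilityMeasure P] (hB : IsStandardWiener P 𝓖 B)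
    (hst : s ≤ t) (hζ : AEStronglyMeasurable[𝓖 s] ζ P) :
    ∫ ω, (ζ * ((⇑(B t) - ⇑(B s)) * (⇑(B t) - ⇑(B s)))) ω ∂P = (t - s) * ∫ ω, ζ ω ∂P := by
  have h0 : ∫ ω, (⇑(B t) - ⇑(B s)) ω ∂P = 0 :=
    (hB.law s t hst).integral_eq.trans integral_id_gaussianReal
  have h : ∫ ω, ((⇑(B t) - ⇑(B s)) * (⇑(B t) - ⇑(B s))) ω ∂P = t - s := by
    have h1 : Var[⇑(B t) - ⇑(B s); P] = t - s := by
      refine (hB.law s t hst).variance_eq.trans ?_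
      rw [variance_id_gaussianReal, NNReal.coe_sub hst]
    rw [variance_of_integral_eq_zero (hB.memLp_sub hst 2 (by simp)).1.aemeasurable h0] at h1
    simpa [sq] using h1
  have hm := (hB.memLp_sub hst 2 (by simp)).1
  have hi := ((hB.indepFun hst hζ).comp (φ := id) (ψ := fun x : ℝ => x * x) measurable_id
    (by fun_prop)).integral_mul_eq_mul_integral (hζ.mono (𝓖.le s)) (hm.mul hm)
  rw [← h]
  exact hi.trans (mul_comm _ _)

theorem integrable_mul (hB : IsStandardWiener P 𝓖 B) (hab : a ≤ b) (hcd : c ≤ d)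
    (hζ : MemLp ζ ∞ P) : Integrable (ζ * ((⇑(B b) - ⇑(B a)) * (⇑(B d) - ⇑(B c)))) P := by
  have h : MemLp ((⇑(B b) - ⇑(B a)) * (⇑(B d) - ⇑(B c))) 1 P :=
    (hB.memLp_sub hcd 2 (by simp)).mul (hB.memLp_sub hab 2 (by simp))
  exact memLp_one_iff_integrable.1 (h.mul hζ)

/-- Splitting the longer increment at `b` leaves a square and an increment after `b`; the latter has
mean zero against everything known at time `b`. -/
theorem integral_mul_sub_mul_sub_of_common_left [IsProbabilityMeasure P]
    (hB : IsStandardWiener P 𝓖 B) (hcb : c ≤ b) (hbd : b ≤ d) (hζ : MemLp ζ ∞ P)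
    (hζ' : AEStronglyMeasurable[𝓖 c] ζ P) :
    ∫ ω, (ζ * ((⇑(B b) - ⇑(B c)) * (⇑(B d) - ⇑(B c)))) ω ∂P = (b - c) * ∫ ω, ζ ω ∂P := by
  have h : ζ * ((⇑(B b) - ⇑(B c)) * (⇑(B d) - ⇑(B c)))
      = ζ * ((⇑(B b) - ⇑(B c)) * (⇑(B b) - ⇑(B c)))
        + ζ * ((⇑(B b) - ⇑(B c)) * (⇑(B d) - ⇑(B b))) := by ring
  have h2 : AEStronglyMeasurable[𝓖 b] (ζ * (⇑(B b) - ⇑(B c))) P :=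
    (hζ'.mono (𝓖.mono hcb)).mul (hB.aestronglyMeasurable_sub hcb le_rfl)
  rw [h, integral_add' (hB.integrable_mul hcb hcb hζ) (hB.integrable_mul hcb hbd hζ),
    hB.integral_mul_sub_mul_sub_self hcb hζ', ← mul_assoc, hB.integral_mul_sub hbd h2, add_zero]

/-- The factor is the length of `(a, b] ∩ (c, d]`. Assuming `a ≤ c`, the part of the first increment
before `c` is absorbed into the weight and contributes zero; the rest starts at `c`, like the second
increment. It suffices that `ζ` is known at the later left endpoint, as is the case for a product of
two coefficients. -/
theorem integral_mul_sub_mul_sub [IsProbabilityMeasure P] (hB : IsStandardWiener P 𝓖 B)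
    (hab : a ≤ b) (hcd : c ≤ d) (hζ : MemLp ζ ∞ P)
    (hζ' : AEStronglyMeasurable[𝓖 (max a c)] ζ P) :
    ∫ ω, (ζ * ((⇑(B b) - ⇑(B a)) * (⇑(B d) - ⇑(B c)))) ω ∂P
      = max (min (b : ℝ) d - max (a : ℝ) c) 0 * ∫ ω, ζ ω ∂P := by
  wlog hac : a ≤ c generalizing a b c d
  · rw [mul_comm (⇑(B b) - ⇑(B a)), this hcd hab (by rwa [max_comm]) (le_of_not_ge hac),
      min_comm, max_comm (a : ℝ)]
  rw [max_eq_right hac] at hζ'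
  have hac' : (a : ℝ) ≤ c := hac
  rcases le_total b c with hbc | hcb
  · have hbc' : (b : ℝ) ≤ c := hbc
    have h2 : AEStronglyMeasurable[𝓖 c] (ζ * (⇑(B b) - ⇑(B a))) P :=
      hζ'.mul (hB.aestronglyMeasurable_sub hac hbc)
    rw [← mul_assoc, hB.integral_mul_sub hcd h2, max_eq_right, zero_mul]
    rw [max_eq_right hac']
    linarith [min_le_left (b : ℝ) d]
  · have h : ζ * ((⇑(B b) - ⇑(B a)) * (⇑(B d) - ⇑(B c)))
        = ζ * ((⇑(B c) - ⇑(B a)) * (⇑(B d) - ⇑(B c)))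
          + ζ * ((⇑(B b) - ⇑(B c)) * (⇑(B d) - ⇑(B c))) := by ring
    have h2 : AEStronglyMeasurable[𝓖 c] (ζ * (⇑(B c) - ⇑(B a))) P :=
      hζ'.mul (hB.aestronglyMeasurable_sub hac le_rfl)
    have hcb' : (c : ℝ) ≤ b := hcb
    have hcd' : (c : ℝ) ≤ d := hcd
    rw [h, integral_add' (hB.integrable_mul hac hcd hζ) (hB.integrable_mul hcb hcd hζ),
      ← mul_assoc, hB.integral_mul_sub hcd h2, zero_add, max_eq_right hac',
      max_eq_left (sub_nonneg.2 (le_min hcb' hcd'))]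
    rcases le_total b d with hbd | hdb
    · rw [hB.integral_mul_sub_mul_sub_of_common_left hcb hbd hζ hζ',
        min_eq_left (NNReal.coe_le_coe.2 hbd)]
    · rw [mul_comm (⇑(B b) - ⇑(B c)), hB.integral_mul_sub_mul_sub_of_common_left hcd hdb hζ hζ',
        min_eq_right (NNReal.coe_le_coe.2 hdb)]

end IsStandardWiener

/-! ### Elementary processes and the Itô isometry -/

/-- The data of an elementary process `ξ 1_{(a, b]}` on `[0, T]`, where `ξ` is bounded and
`𝓖 a`-measurable. -/
structure ElementaryProcess {Ω : Type*} {mΩ : MeasurableSpace Ω} (𝓖 : Filtration ℝ≥0 mΩ)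
    (T : ℝ≥0) where
  left : ℝ≥0
  right : ℝ≥0
  left_le_right : left ≤ right
  right_le : right ≤ T
  coeff : Ω → ℝ
  measurable_coeff : Measurable[𝓖 left] coeff
  bounded_coeff : ∃ K, ∀ ω, |coeff ω| ≤ K

namespace ElementaryProcess

variable {Ω : Type*} {mΩ : MeasurableSpace Ω} {P : Measure Ω}
  {𝓖 : Filtration ℝ≥0 mΩ} {T : ℝ≥0} (j j' : ElementaryProcess 𝓖 T) {B : ℝ≥0 → Ω →ₘ[P] ℝ}

/-- The process `(s, ω) ↦ ξ(ω) 1_{(a, b]}(s)`. -/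
noncomputable def eval (p : ℝ × Ω) : ℝ :=
  (Set.Ioc (j.left : ℝ) j.right).indicator (fun _ => j.coeff p.2) p.1

/-- The elementary integral `ξ (B b - B a)`. -/
noncomputable def integral (B : ℝ≥0 → Ω →ₘ[P] ℝ) (ω : Ω) : ℝ :=
  j.coeff ω * (B j.right ω - B j.left ω)

theorem memLp_coeff : MemLp j.coeff ∞ P := by
  obtain ⟨K, hK⟩ := j.bounded_coeff
  exact memLp_top_of_bound (j.measurable_coeff.mono (𝓖.le _) le_rfl).aestronglyMeasurable K
    (ae_of_all _ hK)

theorem measurable_eval : Measurable j.eval := by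
  have h : j.eval = (Set.Ioc (j.left : ℝ) j.right ×ˢ Set.univ).indicator
      (fun p : ℝ × Ω => j.coeff p.2) := by
    ext p
    simp [eval, Set.indicator]
  rw [h]
  exact ((j.measurable_coeff.mono (𝓖.le _) le_rfl).comp measurable_snd).indicator
    (measurableSet_Ioc.prod .univ)

theorem memLp_integral (hB : IsStandardWiener P 𝓖 B) : MemLp (j.integral B) 2 P :=
  (hB.memLp_sub j.left_le_right 2 (by simp)).mul j.memLp_coeff

variable [IsProbabilityMeasure P]

theorem memLp_eval :
    MemLp j.eval 2 ((volume.restrict (Set.Icc (0 : ℝ) T)).prod P) := by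
  obtain ⟨K, hK⟩ := j.bounded_coeff
  refine MemLp.of_bound j.measurable_eval.aestronglyMeasurable K (ae_of_all _ fun p => ?_)
  rw [eval]
  refine (norm_indicator_le_norm_self _ _).trans (hK _)

theorem inner_integral (hB : IsStandardWiener P 𝓖 B) :
    inner ℝ ((j.memLp_integral hB).toLp _) ((j'.memLp_integral hB).toLp _)
      = max (min (j.right : ℝ) j'.right - max (j.left : ℝ) j'.left) 0
        * ∫ ω, j.coeff ω * j'.coeff ω ∂P := by
  have h := hB.integral_mul_sub_mul_sub (ζ := j.coeff * j'.coeff) j.left_le_right j'.left_le_right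
    (j'.memLp_coeff.mul j.memLp_coeff)
    ((j.measurable_coeff.mono (𝓖.mono (le_max_left _ _)) le_rfl).mul
      (j'.measurable_coeff.mono (𝓖.mono (le_max_right _ _)) le_rfl)).stronglyMeasurable.aestronglyMeasurable
  refine Eq.trans ?_ h
  rw [L2.inner_def]
  refine integral_congr_ae ?_
  filter_upwards [(j.memLp_integral hB).coeFn_toLp, (j'.memLp_integral hB).coeFn_toLp] with ω h1 h2
  rw [h1, h2]
  simp only [integral, Pi.mul_apply, Pi.sub_apply, RCLike.inner_apply, conj_trivial]
  ring

/-- The product of two elementary processes is a time indicator times a random variable, so the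
integral factors by Fubini. -/
theorem inner_eval :
    inner ℝ (j.memLp_eval (P := P)).toLp (j'.memLp_eval (P := P)).toLp
      = max (min (j.right : ℝ) j'.right - max (j.left : ℝ) j'.left) 0
        * ∫ ω, j.coeff ω * j'.coeff ω ∂P := by
  have hI : volume.real (Set.Ioc (j.left : ℝ) j.right ∩ Set.Ioc (j'.left : ℝ) j'.right)
      = max (min (j.right : ℝ) j'.right - max (j.left : ℝ) j'.left) 0 := by
    rw [Set.Ioc_inter_Ioc, Measure.real, Real.volume_Ioc, ENNReal.toReal_ofReal']
  rw [← hI, L2.inner_def]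
  -- Both intervals lie in `[0, T]`, so restricting Lebesgue measure loses nothing.
  have hsub : Set.Ioc (j.left : ℝ) j.right ∩ Set.Ioc (j'.left : ℝ) j'.right ⊆ Set.Icc 0 (T : ℝ) :=
    fun x hx => ⟨j.left.2.trans hx.1.1.le, hx.1.2.trans (NNReal.coe_le_coe.2 j.right_le)⟩
  have h1 : ∫ s in Set.Icc (0 : ℝ) T, (Set.Ioc (j.left : ℝ) j.right ∩
      Set.Ioc (j'.left : ℝ) j'.right).indicator (1 : ℝ → ℝ) s
      = volume.real (Set.Ioc (j.left : ℝ) j.right ∩ Set.Ioc (j'.left : ℝ) j'.right) := by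
    rw [integral_indicator_one (measurableSet_Ioc.inter measurableSet_Ioc),
      measureReal_restrict_apply (measurableSet_Ioc.inter measurableSet_Ioc),
      Set.inter_eq_left.2 hsub]
  rw [← h1, ← integral_prod_mul]
  refine integral_congr_ae ?_
  filter_upwards [(j.memLp_eval (P := P)).coeFn_toLp, (j'.memLp_eval (P := P)).coeFn_toLp]
    with p h2 h3
  rw [h2, h3]
  by_cases h4 : p.1 ∈ Set.Ioc (j.left : ℝ) j.right <;>
  by_cases h5 : p.1 ∈ Set.Ioc (j'.left : ℝ) j'.right <;>
  simp [eval, Set.indicator, h4, h5, mul_comm]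

/-- **Itô isometry**, as an identity of Gram matrices. -/
theorem inner_eval_eq_inner_integral (hB : IsStandardWiener P 𝓖 B) :
    inner ℝ (j.memLp_eval (P := P)).toLp (j'.memLp_eval (P := P)).toLp
      = inner ℝ ((j.memLp_integral hB).toLp _) ((j'.memLp_integral hB).toLp _) := by
  rw [inner_eval, j.inner_integral j' hB]

end ElementaryProcess

/-- Finite linear combinations of two families with the same Gram matrix have the same norm. -/
theorem norm_linearCombination_eq_of_inner_eq {J E F : Type*} [NormedAddCommGroup E]
    [InnerProductSpace ℝ E] [NormedAddCommGroup F] [InnerProductSpace ℝ F] {a : J → E} {b : J → F}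
    (h : ∀ i j, inner ℝ (a i) (a j) = inner ℝ (b i) (b j)) (x : J →₀ ℝ) :
    ‖Finsupp.linearCombination ℝ a x‖ = ‖Finsupp.linearCombination ℝ b x‖ := by
  have h2 : ‖Finsupp.linearCombination ℝ a x‖ ^ 2 = ‖Finsupp.linearCombination ℝ b x‖ ^ 2 := by
    simp_rw [← real_inner_self_eq_norm_sq, Finsupp.linearCombination_apply, Finsupp.sum, sum_inner,
      inner_sum, inner_smul_left, inner_smul_right, h]
  exact (pow_left_inj₀ (norm_nonneg _) (norm_nonneg _) two_ne_zero).1 h2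

/-! ### Deterministic step functions -/

/-- The step function with the value `c i` on `(iT/(n+1), (i+1)T/(n+1)]`. -/
noncomputable def uniformStep (T : ℝ≥0) (n : ℕ) (c : ℕ → ℝ) (s : ℝ) : ℝ :=
  ∑ i : Fin (n + 1), (Set.Ioc (i * T / (n + 1) : ℝ) ((i + 1) * T / (n + 1))).indicator
    (fun _ => c i) s

theorem uniformStep_eq {T : ℝ≥0} {n : ℕ} (c : ℕ → ℝ) {s : ℝ} (hs : s ∈ Set.Ioc (0 : ℝ) T) :
    ∃ i : ℕ, i ≤ n ∧ s ∈ Set.Ioc (i * T / (n + 1) : ℝ) ((i + 1) * T / (n + 1)) ∧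
      uniformStep T n c s = c i := by
  have hT : (0 : ℝ) < T := hs.1.trans_le hs.2
  have hn : (0 : ℝ) < n + 1 := by positivity
  have hpos : 0 < s * (n + 1) / T := by have := hs.1; positivity
  -- The cells are open on the left, so the index is the ceiling minus one; it exists because `s >
  -- 0`.
  obtain ⟨i, hi⟩ : ∃ i, ⌈s * (n + 1) / T⌉₊ = i + 1 :=
    Nat.exists_eq_succ_of_ne_zero (Nat.ceil_pos.2 hpos).ne'
  have h1 : s * (n + 1) / T ≤ i + 1 := by
    have := Nat.le_ceil (s * (n + 1) / T)
    rw [hi] at this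
    exact_mod_cast this
  have h2 : (i : ℝ) < s * (n + 1) / T := by
    refine Nat.lt_ceil.1 ?_
    omega
  have h3 : i ≤ n := by
    have : (i : ℝ) < n + 1 := h2.trans_le (by
      rw [div_le_iff₀ hT]
      nlinarith [hs.2])
    exact Nat.lt_succ_iff.1 (by exact_mod_cast this)
  have h4 : s ∈ Set.Ioc (i * T / (n + 1) : ℝ) ((i + 1) * T / (n + 1)) := by
    rw [lt_div_iff₀ hT] at h2
    rw [div_le_iff₀ hT] at h1
    exact ⟨(div_lt_iff₀ hn).2 h2, (le_div_iff₀ hn).2 h1⟩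
  refine ⟨i, h3, h4, ?_⟩
  rw [uniformStep, Finset.sum_eq_single (⟨i, Nat.lt_succ_of_le h3⟩ : Fin (n + 1))]
  · exact Set.indicator_of_mem h4 _
  · rintro j - hj
    refine Set.indicator_of_notMem (fun h5 => hj (Fin.ext ?_)) _
    have h6 := h4.1.trans_le h5.2
    have h7 := h5.1.trans_le h4.2
    rw [div_lt_div_iff_of_pos_right hn, mul_lt_mul_iff_left₀ hT] at h6 h7
    norm_cast at h6 h7
    simp only
    omega
  · simp

theorem memLp_uniformStep (T : ℝ≥0) (n : ℕ) (c : ℕ → ℝ) :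
    MemLp (uniformStep T n c) 2 (volume.restrict (Set.Icc (0 : ℝ) T)) :=
  memLp_finsetSum _ fun _ _ => (memLp_const _).indicator measurableSet_Ioc

/-- A bounded continuous function approximates `f` in `L²`; it is uniformly continuous on `[0, T]`,
so sampling it at the left endpoints of a fine grid is uniformly accurate. -/
theorem exists_eLpNorm_sub_uniformStep_le {T : ℝ≥0} {f : ℝ → ℝ}
    (hf : MemLp f 2 (volume.restrict (Set.Icc (0 : ℝ) T))) {ε : ℝ≥0∞} (hε : ε ≠ 0) :
    ∃ n c, eLpNorm (f - uniformStep T n c) 2 (volume.restrict (Set.Icc (0 : ℝ) T)) ≤ ε := by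
  set μ := volume.restrict (Set.Icc (0 : ℝ) T) with hμ
  obtain ⟨δ, hδ, hδε⟩ : ∃ δ : ℝ≥0∞, δ ≠ 0 ∧ δ + δ ≤ ε := ⟨ε / 2, by simp [hε], by simp⟩
  obtain ⟨g, hg, hgm⟩ := hf.exists_boundedContinuous_eLpNorm_sub_le (by simp) hδ
  -- `η` is the uniform error that costs at most `δ` in `L²` of the finite measure `μ`.
  obtain ⟨η, hη, hηδ⟩ : ∃ η : ℝ, 0 < η ∧
      μ Set.univ ^ (2 : ℝ≥0∞).toReal⁻¹ * ENNReal.ofReal η ≤ δ := by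
    have h : Tendsto (fun η : ℝ => μ Set.univ ^ (2 : ℝ≥0∞).toReal⁻¹ * ENNReal.ofReal η) (𝓝[>] 0)
        (𝓝 0) := by
      have h1 : Tendsto (fun η : ℝ => ENNReal.ofReal η) (𝓝[>] 0) (𝓝 0) := by
        have := (ENNReal.continuous_ofReal.tendsto 0).mono_left
          (nhdsWithin_le_nhds (s := Set.Ioi 0))
        simpa using this
      have h2 := ENNReal.Tendsto.const_mul (a := μ Set.univ ^ (2 : ℝ≥0∞).toReal⁻¹) h1
        (Or.inr (ENNReal.rpow_ne_top_of_nonneg (by simp) (measure_ne_top _ _)))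
      simpa using h2
    obtain ⟨η, h1, h2⟩ := ((h.eventually_le_const (pos_iff_ne_zero.2 hδ)).and
      self_mem_nhdsWithin).exists
    exact ⟨η, h2, h1⟩
  have huc := isCompact_Icc.uniformContinuousOn_of_continuous
    (s := Set.Icc (0 : ℝ) T) g.continuous.continuousOn
  obtain ⟨r, hr, hgr⟩ := Metric.uniformContinuousOn_iff.1 huc η hη
  -- This makes the mesh `T / (n + 1)` smaller than `r`.
  obtain ⟨n, hn⟩ := exists_nat_gt (T / r : ℝ)
  have hn' : (0 : ℝ) < n + 1 := by positivity
  refine ⟨n, fun i => g (i * T / (n + 1)), ?_⟩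
  have hsplit : f - uniformStep T n (fun i => g (i * T / (n + 1)))
      = (f - g) + (⇑g - uniformStep T n (fun i => g (i * T / (n + 1)))) := by
    rw [sub_add_sub_cancel]
  rw [hsplit]
  refine (eLpNorm_add_le (hf.1.sub hgm.1) (hgm.1.sub (memLp_uniformStep T n _).1)
    (by norm_num)).trans ((add_le_add hg ?_).trans hδε)
  refine (eLpNorm_le_of_ae_bound (C := η) ?_).trans hηδ
  -- The point `0` belongs to no cell, but it is a null set.
  have h0 : ∀ᵐ s ∂μ, s ≠ 0 := (measure_eq_zero_iff_ae_notMem.1 (by simp [hμ]) :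
    ∀ᵐ s ∂μ, s ∉ ({0} : Set ℝ))
  filter_upwards [h0, ae_restrict_mem measurableSet_Icc] with s hs0 hs
  obtain ⟨i, hi, hsi, heq⟩ := uniformStep_eq (n := n) (fun i => g (i * T / (n + 1)))
    (⟨lt_of_le_of_ne hs.1 hs0.symm, hs.2⟩ : s ∈ Set.Ioc (0 : ℝ) T)
  rw [Pi.sub_apply, heq, ← dist_eq_norm]
  refine (hgr s hs _ ⟨by positivity, hsi.1.le.trans hs.2⟩ ?_).le
  rw [Real.dist_eq, abs_of_nonneg (sub_nonneg.2 hsi.1.le)]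
  calc s - i * T / (n + 1) ≤ (i + 1) * T / (n + 1) - i * T / (n + 1) := by linarith [hsi.2]
    _ = T / (n + 1) := by ring
    _ < r := by
      rw [div_lt_iff₀ hr] at hn
      rw [div_lt_iff₀ hn']
      nlinarith

/-- A deterministic step function as a simple process. -/
noncomputable def uniformStepProcess {Ω : Type*} {mΩ : MeasurableSpace Ω}
    (𝓖 : Filtration ℝ≥0 mΩ) (T : ℝ≥0) (n : ℕ) (c : ℕ → ℝ) : SimpleProcess 𝓖 T where
  n := n + 1
  time i := ((i : ℕ) : ℝ≥0) * T / (n + 1)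
  mono i j hij := by
    have h : ((i : ℕ) : ℝ≥0) ≤ ((j : ℕ) : ℝ≥0) := Nat.cast_le.2 hij
    change ((i : ℕ) : ℝ≥0) * T / (n + 1) ≤ ((j : ℕ) : ℝ≥0) * T / (n + 1)
    gcongr
  time_le i := by
    rw [div_le_iff₀ (by positivity), mul_comm]
    gcongr
    exact_mod_cast i.is_le
  coeff i _ := c i
  measurable_coeff _ := measurable_const
  bounded_coeff i := ⟨|c i|, fun _ => le_rfl⟩

theorem eval_uniformStepProcess {Ω : Type*} {mΩ : MeasurableSpace Ω}
    (𝓖 : Filtration ℝ≥0 mΩ) (T : ℝ≥0) (n : ℕ) (c : ℕ → ℝ) (s : ℝ) (ω : Ω) :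
    (uniformStepProcess 𝓖 T n c).eval s ω = uniformStep T n c s := by
  simp [SimpleProcess.eval, uniformStepProcess, uniformStep]
  rfl

/-! ### The Wiener integral -/

namespace SimpleProcess

variable {Ω : Type*} {mΩ : MeasurableSpace Ω} {P : Measure Ω}
  {𝓖 : Filtration ℝ≥0 mΩ} {T : ℝ≥0} (φ : SimpleProcess 𝓖 T)

/-- The `i`-th summand of a simple process. -/
def elementary (i : Fin φ.n) : ElementaryProcess 𝓖 T where
  left := φ.time i.castSucc
  right := φ.time i.succ
  left_le_right := φ.mono i.castSucc_lt_succ.le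
  right_le := φ.time_le _
  coeff := φ.coeff i
  measurable_coeff := φ.measurable_coeff i
  bounded_coeff := φ.bounded_coeff i

theorem eval_eq_sum (p : ℝ × Ω) : φ.eval p.1 p.2 = ∑ i, (φ.elementary i).eval p := rfl

theorem integral_eq_sum (B : ℝ≥0 → Ω →ₘ[P] ℝ) :
    φ.integral (fun t => ⇑(B t)) = fun ω => ∑ i, (φ.elementary i).integral B ω := rfl

theorem memLp_integral {B : ℝ≥0 → Ω →ₘ[P] ℝ} (hB : IsStandardWiener P 𝓖 B) :
    MemLp (φ.integral (fun t => ⇑(B t))) 2 P := by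
  rw [integral_eq_sum]
  exact memLp_finsetSum _ fun i _ => (φ.elementary i).memLp_integral hB

theorem toLp_integral {B : ℝ≥0 → Ω →ₘ[P] ℝ} (hB : IsStandardWiener P 𝓖 B) :
    (φ.memLp_integral hB).toLp _
      = ∑ i, ((φ.elementary i).memLp_integral hB).toLp ((φ.elementary i).integral B) := by
  ext
  have h2 : ∀ᵐ ω ∂P, ∀ i, ((φ.elementary i).memLp_integral hB).toLp
      ((φ.elementary i).integral B) ω = (φ.elementary i).integral B ω :=
    ae_all_iff.2 fun i => MemLp.coeFn_toLp _
  filter_upwards [(φ.memLp_integral hB).coeFn_toLp, Lp.coeFn_finsetSum Finset.univ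
    (fun i => ((φ.elementary i).memLp_integral hB).toLp ((φ.elementary i).integral B)), h2]
    with ω h1 h3 h4
  rw [h1, h3, integral_eq_sum, Finset.sum_apply]
  simp [h4]

variable [IsProbabilityMeasure P]

theorem memLp_eval :
    MemLp (fun p : ℝ × Ω => φ.eval p.1 p.2) 2
      ((volume.restrict (Set.Icc (0 : ℝ) T)).prod P) := by
  simp_rw [eval_eq_sum]
  exact memLp_finsetSum _ fun i _ => (φ.elementary i).memLp_eval

theorem toLp_eval :
    (φ.memLp_eval (P := P)).toLp _ = ∑ i, ((φ.elementary i).memLp_eval (P := P)).toLp _ := by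
  ext
  have h2 : ∀ᵐ p ∂((volume.restrict (Set.Icc (0 : ℝ) T)).prod P), ∀ i,
      ((φ.elementary i).memLp_eval (P := P)).toLp _ p = (φ.elementary i).eval p :=
    ae_all_iff.2 fun i => MemLp.coeFn_toLp _
  filter_upwards [(φ.memLp_eval (P := P)).coeFn_toLp, Lp.coeFn_finsetSum Finset.univ
    (fun i => ((φ.elementary i).memLp_eval (P := P)).toLp _), h2] with p h1 h3 h4
  rw [h1, h3, eval_eq_sum, Finset.sum_apply]
  simp [h4]

end SimpleProcess

/-- The deterministic elementary process `1_{(0, t]}`. -/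
def ElementaryProcess.unit {Ω : Type*} {mΩ : MeasurableSpace Ω} (𝓖 : Filtration ℝ≥0 mΩ) {T : ℝ≥0}
    (t : Set.Iic T) : ElementaryProcess 𝓖 T where
  left := 0
  right := t
  left_le_right := zero_le
  right_le := t.2
  coeff _ := 1
  measurable_coeff := measurable_const
  bounded_coeff := ⟨1, fun _ => by simp⟩

/-- The class of `1_{(0, t]}` in `L²([0, T])`. -/
noncomputable def indicatorIoc (T : ℝ≥0) (t : Set.Iic T) :
    Lp ℝ 2 (volume.restrict (Set.Icc (0 : ℝ) T)) :=
  indicatorConstLp 2 (measurableSet_Ioc (a := (0 : ℝ)) (b := t)) (measure_ne_top _ _) 1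

/-- Each cell indicator `1_{(a, b]}` is `1_{(0, b]} - 1_{(0, a]}`. -/
theorem uniformStep_mem_span (T : ℝ≥0) (n : ℕ) (c : ℕ → ℝ) :
    (memLp_uniformStep T n c).toLp _ ∈ Submodule.span ℝ (Set.range (indicatorIoc T)) := by
  have ht : ∀ i : ℕ, i ≤ n + 1 → (i : ℝ≥0) * T / (n + 1) ≤ T := fun i hi => by
    rw [div_le_iff₀ (by positivity), mul_comm]
    gcongr
    exact_mod_cast hi
  have h : (memLp_uniformStep T n c).toLp _ = ∑ i : Fin (n + 1), c i •
      (indicatorIoc T ⟨_, ht (i + 1) (by omega)⟩ - indicatorIoc T ⟨_, ht i (by omega)⟩) := by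
    ext
    have h1 : ∀ᵐ s ∂(volume.restrict (Set.Icc (0 : ℝ) T)), ∀ i : Fin (n + 1), (c i •
        (indicatorIoc T ⟨_, ht (i + 1) (by omega)⟩ - indicatorIoc T ⟨_, ht i (by omega)⟩) : Lp ℝ 2
          (volume.restrict (Set.Icc (0 : ℝ) T))) s
        = (Set.Ioc (i * T / (n + 1) : ℝ) ((i + 1) * T / (n + 1))).indicator (fun _ => c i) s := by
      refine ae_all_iff.2 fun i => ?_
      filter_upwards [Lp.coeFn_smul (c i) (indicatorIoc T ⟨_, ht (i + 1) (by omega)⟩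
        - indicatorIoc T ⟨_, ht i (by omega)⟩), Lp.coeFn_sub (indicatorIoc T ⟨_, ht (i + 1)
        (by omega)⟩) (indicatorIoc T ⟨_, ht i (by omega)⟩), indicatorConstLp_coeFn (p := 2)
        (hs := measurableSet_Ioc (a := (0 : ℝ))
          (b := ((((i + 1 : ℕ) : ℝ≥0) * T / (n + 1) : ℝ≥0) : ℝ)))
        (hμs := measure_ne_top (volume.restrict (Set.Icc (0 : ℝ) T)) _) (c := (1 : ℝ)),
        indicatorConstLp_coeFn (p := 2)
        (hs := measurableSet_Ioc (a := (0 : ℝ)) (b := ((((i : ℕ) : ℝ≥0) * T / (n + 1) : ℝ≥0) : ℝ)))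
        (hμs := measure_ne_top (volume.restrict (Set.Icc (0 : ℝ) T)) _) (c := (1 : ℝ))]
        with s h2 h3 h4 h5
      rw [h2, Pi.smul_apply, h3, Pi.sub_apply]
      unfold indicatorIoc
      rw [h4, h5]
      have hle : (i : ℝ) * T / (n + 1) ≤ (i + 1) * T / (n + 1) := by gcongr; linarith
      have h0 : 0 ≤ (i : ℝ) * T / (n + 1) := by positivity
      simp only [Set.indicator, Set.mem_Ioc]
      push_cast
      split_ifs <;> first | (exfalso; grind) | simp
    filter_upwards [(memLp_uniformStep T n c).coeFn_toLp, Lp.coeFn_finsetSum Finset.univ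
      (fun i : Fin (n + 1) => (c i • (indicatorIoc T ⟨_, ht (i + 1) (by omega)⟩
        - indicatorIoc T ⟨_, ht i (by omega)⟩) : Lp ℝ 2 (volume.restrict (Set.Icc (0 : ℝ) T)))), h1]
      with s h2 h3 h4
    rw [h2, h3, Finset.sum_apply, uniformStep]
    exact Finset.sum_congr rfl fun i _ => (h4 i).symm
  rw [h]
  exact Submodule.sum_mem _ fun i _ => Submodule.smul_mem _ _ (Submodule.sub_mem _
    (Submodule.subset_span ⟨_, rfl⟩) (Submodule.subset_span ⟨_, rfl⟩))

theorem denseRange_linearCombination_indicatorIoc (T : ℝ≥0) :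
    DenseRange (Finsupp.linearCombination ℝ (indicatorIoc T)) := by
  intro f
  rw [Metric.mem_closure_range_iff]
  intro ε hε
  obtain ⟨n, c, h⟩ := exists_eLpNorm_sub_uniformStep_le (Lp.memLp f)
    (ε := ENNReal.ofReal (ε / 2)) (by simp [hε])
  obtain ⟨x, hx⟩ : ∃ x, Finsupp.linearCombination ℝ (indicatorIoc T) x
      = (memLp_uniformStep T n c).toLp _ := by
    have := uniformStep_mem_span T n c
    rwa [← Finsupp.range_linearCombination] at this
  refine ⟨x, ?_⟩
  rw [hx, Lp.dist_def]
  have h2 : eLpNorm (⇑f - ⇑((memLp_uniformStep T n c).toLp _)) 2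
      (volume.restrict (Set.Icc (0 : ℝ) T)) ≤ ENNReal.ofReal (ε / 2) := by
    refine (eLpNorm_congr_ae ?_).trans_le h
    exact EventuallyEq.rfl.sub (memLp_uniformStep T n c).coeFn_toLp
  have h3 := ENNReal.toReal_mono (by simp) h2
  rw [ENNReal.toReal_ofReal (by positivity)] at h3
  linarith

namespace ElementaryProcess

variable {Ω : Type*} {mΩ : MeasurableSpace Ω} {P : Measure Ω} [IsProbabilityMeasure P]
  {𝓖 : Filtration ℝ≥0 mΩ} {T : ℝ≥0} {B : ℝ≥0 → Ω →ₘ[P] ℝ}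

/-- The class of an elementary process in `L²([0, T] × Ω)`. -/
noncomputable def evalLp (P : Measure Ω) [IsProbabilityMeasure P] (j : ElementaryProcess 𝓖 T) :
    Lp ℝ 2 ((volume.restrict (Set.Icc (0 : ℝ) T)).prod P) :=
  j.memLp_eval.toLp _

/-- The class of an elementary integral in `L²(Ω)`. -/
noncomputable def integralLp (hB : IsStandardWiener P 𝓖 B) (j : ElementaryProcess 𝓖 T) :
    Lp ℝ 2 P :=
  (j.memLp_integral hB).toLp _

theorem norm_linearCombination (hB : IsStandardWiener P 𝓖 B) (x : ElementaryProcess 𝓖 T →₀ ℝ) :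
    ‖Finsupp.linearCombination ℝ (evalLp P) x‖
      = ‖Finsupp.linearCombination ℝ (integralLp hB) x‖ :=
  norm_linearCombination_eq_of_inner_eq (fun i j => i.inner_eval_eq_inner_integral j hB) x

end ElementaryProcess

section WienerIntegral

variable {Ω : Type*} {mΩ : MeasurableSpace Ω} {P : Measure Ω}
  {𝓖 : Filtration ℝ≥0 mΩ} {T : ℝ≥0} {B : ℝ≥0 → Ω →ₘ[P] ℝ}

theorem ProbabilityTheory.IsPreBrownianReal.memLp_two
    (hB : IsPreBrownianReal (fun t => ⇑(B t)) P) (t : ℝ≥0) : MemLp (B t) 2 P :=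
  (hB.isGaussianProcess.hasGaussianLaw_eval t).memLp_two

/-- The Wiener integral `L²([0, T]) → L²(Ω)`, the extension of `1_{(0, t]} ↦ B t`. -/
noncomputable def wienerIntegral (hB : IsPreBrownianReal (fun t => ⇑(B t)) P) (T : ℝ≥0) :
    Lp ℝ 2 (volume.restrict (Set.Icc (0 : ℝ) T)) →L[ℝ] Lp ℝ 2 P :=
  (Finsupp.linearCombination ℝ (fun t : Set.Iic T => (hB.memLp_two t).toLp (B t))).extendOfNorm
    (Finsupp.linearCombination ℝ (indicatorIoc T))

theorem toLp_eq_integralLp_unit (hB : IsPreBrownianReal (fun t => ⇑(B t)) P)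
    (hB' : IsStandardWiener P 𝓖 B) (t : Set.Iic T) :
    (hB.memLp_two t).toLp (B t) = (ElementaryProcess.unit 𝓖 t).integralLp hB' := by
  refine MemLp.toLp_congr _ _ ?_
  filter_upwards [hB.eval_zero_ae_eq_zero] with ω hω
  simp [ElementaryProcess.integral, ElementaryProcess.unit, hω]

theorem linearCombination_toLp_eq (hB : IsPreBrownianReal (fun t => ⇑(B t)) P)
    (hB' : IsStandardWiener P 𝓖 B) (x : Set.Iic T →₀ ℝ) :
    Finsupp.linearCombination ℝ (fun t : Set.Iic T => (hB.memLp_two t).toLp (B t)) x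
      = Finsupp.linearCombination ℝ (ElementaryProcess.integralLp hB')
        (x.mapDomain (ElementaryProcess.unit 𝓖)) := by
  rw [Finsupp.linearCombination_mapDomain]
  congr 2
  ext1 t
  exact toLp_eq_integralLp_unit hB hB' t

theorem eLpNorm_integral_sub_eq_enorm (hB : IsStandardWiener P 𝓖 B) (φ : SimpleProcess 𝓖 T)
    (X : Lp ℝ 2 P) :
    eLpNorm (fun ω => φ.integral (fun t => ⇑(B t)) ω - X ω) 2 P
      = ‖(φ.memLp_integral hB).toLp _ - X‖ₑ := by
  rw [Lp.enorm_def]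
  refine eLpNorm_congr_ae ?_
  filter_upwards [Lp.coeFn_sub ((φ.memLp_integral hB).toLp _) X, (φ.memLp_integral hB).coeFn_toLp]
    with ω h1 h2
  rw [h1, Pi.sub_apply, h2]

variable [IsProbabilityMeasure P]

/-- The embedding of `L²([0, T])` into `L²([0, T] × Ω)`. -/
noncomputable def constLp (P : Measure Ω) [IsProbabilityMeasure P] (T : ℝ≥0) :
    Lp ℝ 2 (volume.restrict (Set.Icc (0 : ℝ) T)) →ₗᵢ[ℝ]
      Lp ℝ 2 ((volume.restrict (Set.Icc (0 : ℝ) T)).prod P) :=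
  Lp.compMeasurePreservingₗᵢ ℝ Prod.fst measurePreserving_fst

theorem constLp_linearCombination (𝓖 : Filtration ℝ≥0 mΩ) (x : Set.Iic T →₀ ℝ) :
    constLp P T (Finsupp.linearCombination ℝ (indicatorIoc T) x)
      = Finsupp.linearCombination ℝ (ElementaryProcess.evalLp P)
        (x.mapDomain (ElementaryProcess.unit 𝓖)) := by
  rw [Finsupp.linearCombination_mapDomain]
  refine (Finsupp.apply_linearCombination ℝ (constLp P T).toLinearMap (indicatorIoc T) x).trans ?_
  congr 2

/-- This is the Itô isometry for elementary processes, read through the isometric embedding of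
`L²([0, T])` into `L²([0, T] × Ω)`. It supplies the bound under which `extendOfNorm` really extends.
-/
theorem norm_linearCombination_toLp_eq (hB : IsPreBrownianReal (fun t => ⇑(B t)) P)
    (x : Set.Iic T →₀ ℝ) :
    ‖Finsupp.linearCombination ℝ (fun t : Set.Iic T => (hB.memLp_two t).toLp (B t)) x‖
      = ‖Finsupp.linearCombination ℝ (indicatorIoc T) x‖ := by
  rw [linearCombination_toLp_eq hB hB.isStandardWiener,
    ← ElementaryProcess.norm_linearCombination hB.isStandardWiener, ← constLp_linearCombination,
    LinearIsometry.norm_map]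

theorem wienerIntegral_linearCombination (hB : IsPreBrownianReal (fun t => ⇑(B t)) P)
    (x : Set.Iic T →₀ ℝ) :
    wienerIntegral hB T (Finsupp.linearCombination ℝ (indicatorIoc T) x)
      = Finsupp.linearCombination ℝ (fun t : Set.Iic T => (hB.memLp_two t).toLp (B t)) x :=
  LinearMap.extendOfNorm_eq (denseRange_linearCombination_indicatorIoc T)
    ⟨1, fun x => by rw [one_mul]; exact (norm_linearCombination_toLp_eq hB x).le⟩ x

theorem norm_wienerIntegral (hB : IsPreBrownianReal (fun t => ⇑(B t)) P)
    (f : Lp ℝ 2 (volume.restrict (Set.Icc (0 : ℝ) T))) : ‖wienerIntegral hB T f‖ = ‖f‖ := by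
  refine (denseRange_linearCombination_indicatorIoc T).induction_on
    (p := fun f => ‖wienerIntegral hB T f‖ = ‖f‖) f
    (isClosed_eq (by fun_prop) (by fun_prop)) fun x => ?_
  rw [wienerIntegral_linearCombination, norm_linearCombination_toLp_eq hB]

/-- Used twice: with an orthogonal complement, to separate the different `B_k`, and with the closed
Gaussian span, to find the law of the integral. -/
theorem wienerIntegral_mem (hB : IsPreBrownianReal (fun t => ⇑(B t)) P)
    {K : Submodule ℝ (Lp ℝ 2 P)} (hK : IsClosed (K : Set (Lp ℝ 2 P)))
    (h : ∀ t, (hB.memLp_two t).toLp (B t) ∈ K)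
    (f : Lp ℝ 2 (volume.restrict (Set.Icc (0 : ℝ) T))) : wienerIntegral hB T f ∈ K := by
  refine (denseRange_linearCombination_indicatorIoc T).induction_on
    (p := fun f => wienerIntegral hB T f ∈ K) f
    (hK.preimage (wienerIntegral hB T).continuous) fun x => ?_
  rw [wienerIntegral_linearCombination, Finsupp.linearCombination_apply]
  exact Submodule.sum_mem _ fun t _ => K.smul_mem _ (h t)

/-- The Itô isometry for the difference of a simple process and a deterministic integrand. -/
theorem norm_integral_sub_wienerIntegral (hB : IsPreBrownianReal (fun t => ⇑(B t)) P)
    (hB' : IsStandardWiener P 𝓖 B) (φ : SimpleProcess 𝓖 T)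
    (f : Lp ℝ 2 (volume.restrict (Set.Icc (0 : ℝ) T))) :
    ‖(φ.memLp_integral hB').toLp _ - wienerIntegral hB T f‖
      = ‖(φ.memLp_eval (P := P)).toLp _ - constLp P T f‖ := by
  refine (denseRange_linearCombination_indicatorIoc T).induction_on
    (p := fun f => ‖(φ.memLp_integral hB').toLp _ - wienerIntegral hB T f‖
      = ‖(φ.memLp_eval (P := P)).toLp _ - constLp P T f‖) f
    (isClosed_eq (by fun_prop) (by fun_prop)) fun x => ?_
  -- Both sides are continuous in `f`, so `f` may be a combination of the `1_{(0, t]}`. Then `φ - f`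
  -- is itself a combination of elementary processes, to which the isometry applies.
  have h := ElementaryProcess.norm_linearCombination hB'
    ((∑ i, Finsupp.single (φ.elementary i) 1) - x.mapDomain (ElementaryProcess.unit 𝓖))
  rw [map_sub, map_sub, map_sum, map_sum, ← constLp_linearCombination,
    ← linearCombination_toLp_eq hB hB'] at h
  simp only [Finsupp.linearCombination_single, one_smul] at h
  rw [wienerIntegral_linearCombination, φ.toLp_integral hB', φ.toLp_eval]
  exact h.symm

theorem lintegral_sub_eval_eq {f : ℝ → ℝ}
    (hf : MemLp f 2 (volume.restrict (Set.Icc (0 : ℝ) T))) (φ : SimpleProcess 𝓖 T) :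
    ∫⁻ s in Set.Icc (0 : ℝ) T, ∫⁻ ω, ‖f s - φ.eval s ω‖ₑ ^ 2 ∂P
      = ‖(φ.memLp_eval (P := P)).toLp _ - constLp P T (hf.toLp f)‖ₑ ^ 2 := by
  have hm := hf.1.comp_quasiMeasurePreserving
    (measurePreserving_fst (ν := P)).quasiMeasurePreserving
  have h2 : (hf.comp_measurePreserving (measurePreserving_fst (ν := P))).toLp _
      = constLp P T (hf.toLp f) := rfl
  rw [← lintegral_prod (fun p : ℝ × Ω => ‖f p.1 - φ.eval p.1 p.2‖ₑ ^ 2), ← h2, ← MemLp.toLp_sub,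
    Lp.enorm_toLp, eLpNorm_eq_lintegral_rpow_enorm_toReal (by simp) (by simp)]
  · rw [← ENNReal.rpow_natCast, ← ENNReal.rpow_mul]
    simp [enorm_sub_rev]
  · exact ((hm.sub (φ.memLp_eval (P := P)).1).enorm.pow_const 2)

theorem eLpNorm_integral_sub_wienerIntegral (hB : IsPreBrownianReal (fun t => ⇑(B t)) P)
    (hB' : IsStandardWiener P 𝓖 B) {f : ℝ → ℝ}
    (hf : MemLp f 2 (volume.restrict (Set.Icc (0 : ℝ) T))) (φ : SimpleProcess 𝓖 T) :
    eLpNorm (fun ω => φ.integral (fun t => ⇑(B t)) ω - wienerIntegral hB T (hf.toLp f) ω) 2 P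
      = (∫⁻ s in Set.Icc (0 : ℝ) T, ∫⁻ ω, ‖f s - φ.eval s ω‖ₑ ^ 2 ∂P) ^ (2⁻¹ : ℝ) := by
  rw [eLpNorm_integral_sub_eq_enorm hB', lintegral_sub_eval_eq hf, ← ENNReal.rpow_natCast,
    ← ENNReal.rpow_mul, ← ofReal_norm,
    norm_integral_sub_wienerIntegral hB hB', ofReal_norm]
  simp

theorem tendsto_eLpNorm_integral_sub_wienerIntegral
    (hB : IsPreBrownianReal (fun t => ⇑(B t)) P) (hB' : IsStandardWiener P 𝓖 B) {f : ℝ → ℝ}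
    (hf : MemLp f 2 (volume.restrict (Set.Icc (0 : ℝ) T))) {φ : ℕ → SimpleProcess 𝓖 T}
    (h : Tendsto (fun n => ∫⁻ s in Set.Icc (0 : ℝ) T, ∫⁻ ω, ‖f s - (φ n).eval s ω‖ₑ ^ 2 ∂P)
      atTop (𝓝 0)) :
    Tendsto (fun n => eLpNorm (fun ω => (φ n).integral (fun t => ⇑(B t)) ω
      - wienerIntegral hB T (hf.toLp f) ω) 2 P) atTop (𝓝 0) := by
  simp_rw [eLpNorm_integral_sub_wienerIntegral hB hB' hf]
  have := h.ennrpow_const (2⁻¹ : ℝ)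
  simpa using this

theorem isItoIntegral_wienerIntegral (hB : IsPreBrownianReal (fun t => ⇑(B t)) P) {f : ℝ → ℝ}
    (hf : MemLp f 2 (volume.restrict (Set.Icc (0 : ℝ) T))) :
    IsItoIntegral P B T (fun s _ => f s) (wienerIntegral hB T (hf.toLp f)) := by
  choose k c h using fun n : ℕ => exists_eLpNorm_sub_uniformStep_le hf
    (ε := ((n : ℝ≥0∞) + 1)⁻¹) (by simp)
  have key : Tendsto (fun n => ∫⁻ s in Set.Icc (0 : ℝ) T, ∫⁻ ω, ‖f s - (uniformStepProcess
      (Filtration.natural (fun t => ⇑(B t)) fun t => (B t).stronglyMeasurable) T (k n)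
      (c n)).eval s ω‖ₑ ^ 2 ∂P) atTop (𝓝 0) := by
    have h1 : ∀ n, ∫⁻ s in Set.Icc (0 : ℝ) T, ∫⁻ ω, ‖f s - (uniformStepProcess
        (Filtration.natural (fun t => ⇑(B t)) fun t => (B t).stronglyMeasurable) T (k n)
        (c n)).eval s ω‖ₑ ^ 2 ∂P
        = eLpNorm (f - uniformStep T (k n) (c n)) 2 (volume.restrict (Set.Icc (0 : ℝ) T)) ^ 2 := by
      intro n
      simp_rw [eval_uniformStepProcess, lintegral_const, measure_univ, mul_one]
      rw [eLpNorm_eq_lintegral_rpow_enorm_toReal (by simp) (by simp), ← ENNReal.rpow_natCast,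
        ← ENNReal.rpow_mul]
      simp
    simp_rw [h1]
    have h2 : Tendsto (fun n : ℕ => ((n : ℝ≥0∞) + 1)⁻¹) atTop (𝓝 0) := by
      have := (tendsto_add_atTop_iff_nat 1).2 ENNReal.tendsto_inv_nat_nhds_zero
      simpa using this
    have h3 := ENNReal.Tendsto.pow (n := 2) (tendsto_of_tendsto_of_tendsto_of_le_of_le
      tendsto_const_nhds h2 (fun _ => zero_le) h)
    simpa using h3
  exact ⟨_, hB.isStandardWiener, fun n => uniformStepProcess _ T (k n) (c n), key,
    tendsto_eLpNorm_integral_sub_wienerIntegral hB hB.isStandardWiener hf key⟩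

/-- The isometry holds for every filtration making `B` a standard Wiener process, so any admissible
approximating sequence has the same limit. Hence the choice made in `itoIntegral` is harmless. -/
theorem IsItoIntegral.eq_wienerIntegral (hB : IsPreBrownianReal (fun t => ⇑(B t)) P) {f : ℝ → ℝ}
    (hf : MemLp f 2 (volume.restrict (Set.Icc (0 : ℝ) T))) {X : Lp ℝ 2 P}
    (hX : IsItoIntegral P B T (fun s _ => f s) X) : X = wienerIntegral hB T (hf.toLp f) := by
  obtain ⟨𝓖, hB', φ, h1, h2⟩ := hX
  have h3 := tendsto_eLpNorm_integral_sub_wienerIntegral hB hB' hf h1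
  simp_rw [eLpNorm_integral_sub_eq_enorm hB', ← edist_eq_enorm_sub] at h2 h3
  exact tendsto_nhds_unique (tendsto_iff_edist_tendsto_0.2 h2) (tendsto_iff_edist_tendsto_0.2 h3)

theorem itoIntegral_eq_wienerIntegral (hB : IsPreBrownianReal (fun t => ⇑(B t)) P) {f : ℝ → ℝ}
    (hf : MemLp f 2 (volume.restrict (Set.Icc (0 : ℝ) T))) :
    itoIntegral P B T (fun s _ => f s) = wienerIntegral hB T (hf.toLp f) := by
  have h : ∃ X, IsItoIntegral P B T (fun s _ => f s) X := ⟨_, isItoIntegral_wienerIntegral hB hf⟩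
  rw [itoIntegral, dif_pos h]
  exact h.choose_spec.eq_wienerIntegral hB hf

end WienerIntegral

/-! ### Centred Gaussian laws in closed subspaces of `L²(Ω)` -/

section GaussianSpace

variable {Ω : Type*} {mΩ : MeasurableSpace Ω} {P : Measure Ω}

/-- An `L²` limit of centred Gaussian random variables is a centred Gaussian random variable. -/
theorem hasLaw_gaussianReal_of_mem_closure [IsProbabilityMeasure P]
    {S : Set (Lp ℝ 2 P)}
    (hS : ∀ Y ∈ S, HasLaw Y (gaussianReal 0 (‖Y‖₊ ^ 2)) P) {X : Lp ℝ 2 P} (hX : X ∈ closure S) :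
    HasLaw X (gaussianReal 0 (‖X‖₊ ^ 2)) P := by
  obtain ⟨Y, hYS, hY⟩ := mem_closure_iff_seq_limit.1 hX
  have hm : ∀ Z : Lp ℝ 2 P, AEMeasurable Z P := fun Z => (Lp.stronglyMeasurable Z).aemeasurable
  -- Convergence in `L²` gives convergence in law, hence of characteristic functions. These depend
  -- only on the norm, which is continuous, so their limit is again of the centred Gaussian form.
  have h1 := ((tendstoInMeasure_of_tendsto_Lp hY).tendstoInDistribution (fun n => hm (Y n))).tendsto
  have h1 := fun t => ProbabilityMeasure.tendsto_iff_tendsto_charFun.1 h1 t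
  refine ⟨hm X, ?_⟩
  have : IsProbabilityMeasure (P.map X) := Measure.isProbabilityMeasure_map (hm X)
  refine Measure.ext_of_charFun ?_
  ext t
  refine tendsto_nhds_unique (h1 t) ?_
  simp only [ProbabilityMeasure.coe_mk, fun n => (hS (Y n) (hYS n)).map_eq, charFun_gaussianReal]
  have h2 : Continuous fun Z : Lp ℝ 2 P =>
      Complex.exp (t * (0 : ℝ) * Complex.I - ((‖Z‖₊ ^ 2 : ℝ≥0) : ℝ) * t ^ 2 / 2) := by
    fun_prop
  exact (h2.tendsto X).comp hY

/-- Finite linear combinations of a centred Gaussian process are centred Gaussian. -/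
theorem ProbabilityTheory.IsGaussianProcess.hasLaw_of_mem_span {J : Type*} {G : J → Ω → ℝ}
    (hG : IsGaussianProcess G P) (h0 : ∀ j, ∫ ω, G j ω ∂P = 0) {Y : Lp ℝ 2 P}
    (hY : Y ∈ Submodule.span ℝ
      (Set.range fun j => ((hG.hasGaussianLaw_eval j).memLp_two).toLp (G j))) :
    HasLaw Y (gaussianReal 0 (‖Y‖₊ ^ 2)) P := by
  rw [← Finsupp.range_linearCombination] at hY
  obtain ⟨x, rfl⟩ := hY
  set Y := Finsupp.linearCombination ℝ
    (fun j => ((hG.hasGaussianLaw_eval j).memLp_two).toLp (G j)) x with hYdef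
  have hY : Y =ᵐ[P] fun ω => ∑ j ∈ x.support, x j • G j ω := by
    have h1 : ∀ᵐ ω ∂P, ∀ j : x.support,
        (x j • ((hG.hasGaussianLaw_eval j).memLp_two).toLp (G j) : Lp ℝ 2 P) ω = x j • G j ω := by
      refine ae_all_iff.2 fun j => ?_
      filter_upwards [Lp.coeFn_smul (x j) (((hG.hasGaussianLaw_eval j).memLp_two).toLp (G j)),
        ((hG.hasGaussianLaw_eval (j : J)).memLp_two).coeFn_toLp] with ω h1 h2
      rw [h1, Pi.smul_apply, h2]
    filter_upwards [h1, Lp.coeFn_finsetSum x.support (fun j =>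
      (x j • ((hG.hasGaussianLaw_eval j).memLp_two).toLp (G j) : Lp ℝ 2 P))] with ω h1 h2
    rw [hYdef, Finsupp.linearCombination_apply, Finsupp.sum, h2, Finset.sum_apply]
    exact Finset.sum_congr rfl fun j hj => h1 ⟨j, hj⟩
  have hgauss : HasGaussianLaw Y P :=
    ((hG.smul x).hasGaussianLaw_fun_sum (I := x.support)).congr hY.symm
  have hmean : ∫ ω, Y ω ∂P = 0 := by
    rw [integral_congr_ae hY, integral_finsetSum (f := fun j ω => x j • G j ω) _ fun j _ =>
      (hG.hasGaussianLaw_eval j).integrable.smul (x j)]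
    exact Finset.sum_eq_zero fun j _ => by rw [integral_smul, h0, smul_zero]
  refine ⟨hgauss.aemeasurable, ?_⟩
  rw [hgauss.map_eq_gaussianReal, hmean, variance_of_integral_eq_zero hgauss.aemeasurable hmean]
  congr 1
  rw [← NNReal.coe_inj, Real.coe_toNNReal _ (integral_nonneg fun _ => by positivity)]
  push_cast
  rw [← real_inner_self_eq_norm_sq, L2.inner_def]
  simp [sq]

end GaussianSpace

/-! ### Linear families of random variables induced by a `V`-valued one -/

/-- In a separable normed space a sequence of functionals separates the points. -/
theorem exists_seq_dual_separating (V : Type*) [NormedAddCommGroup V] [NormedSpace ℝ V]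
    [TopologicalSpace.SeparableSpace V] :
    ∃ d : ℕ → StrongDual ℝ V, ∀ y, (∀ n, d n y = 0) → y = 0 := by
  choose d hd1 hd2 using fun n => exists_dual_vector'' ℝ (TopologicalSpace.denseSeq V n)
  refine ⟨d, fun y hy => ?_⟩
  by_contra hne
  have hpos : 0 < ‖y‖ / 2 := by have := norm_pos_iff.2 hne; positivity
  obtain ⟨n, hn⟩ := (TopologicalSpace.denseRange_denseSeq V).exists_dist_lt y hpos
  set x := TopologicalSpace.denseSeq V n
  have h1 : ‖x‖ ≤ ‖x - y‖ := by
    have h2 : d n (x - y) = ‖x‖ := by rw [map_sub, hy n, sub_zero]; exact hd2 n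
    rw [← h2]
    exact (le_abs_self _).trans (((d n).le_opNorm _).trans
      (mul_le_of_le_one_left (norm_nonneg _) (hd1 n)))
  rw [dist_eq_norm, norm_sub_rev] at hn
  have h3 := norm_sub_norm_le y x
  rw [norm_sub_rev] at h3
  linarith

section Induced

variable {Ω : Type*} {mΩ : MeasurableSpace Ω} {P : Measure Ω}
  {V : Type*} [NormedAddCommGroup V] [NormedSpace ℝ V] [MeasurableSpace V] [BorelSpace V]

theorem map_eq_gaussianReal_of_isInducedBy {X : StrongDual ℝ V → Lp ℝ 2 P}
    (hX : ∀ v, HasLaw (X v) (gaussianReal 0 (‖X v‖₊ ^ 2)) P) {Z : Ω → V} (hZ : Measurable Z)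
    (h : IsInducedBy P (fun v => (X v : Ω →ₘ[P] ℝ)) Z) (v : StrongDual ℝ V) :
    (P.map Z).map v = gaussianReal 0 (‖X v‖₊ ^ 2) := by
  rw [Measure.map_map v.continuous.measurable hZ, ← (hX v).map_eq]
  exact (Measure.map_congr (h v)).symm

variable [IsProbabilityMeasure P]

/-- Two linear families of random variables with the same one-dimensional laws have the same
joint laws along sequences. -/
theorem map_pi_eq_of_forall_map_eq {ν : Measure V} [IsProbabilityMeasure ν]
    (X : StrongDual ℝ V →ₗ[ℝ] Lp ℝ 2 P) (h : ∀ v, P.map (X v) = ν.map v)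
    (w : ℕ → StrongDual ℝ V) :
    P.map (fun ω n => X (w n) ω) = ν.map (fun x n => w n x) := by
  have hXm : ∀ v, Measurable (X v) := fun v => (Lp.stronglyMeasurable _).measurable
  have h1 := isProjectiveLimit_map (P := P) (X := fun n => ⇑(X (w n)))
    (measurable_pi_lambda _ fun n => hXm _).aemeasurable
  have h2 := isProjectiveLimit_map (P := ν) (X := fun n => ⇑(w n))
    (measurable_pi_lambda _ fun n => (w n).continuous.measurable).aemeasurable
  have : ∀ I : Finset ℕ, IsFiniteMeasure (ν.map fun x => I.restrict (fun n => w n x)) :=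
    fun I => inferInstance
  refine IsProjectiveLimit.unique ?_ h2
  convert h1 using 2 with I
  have hm1 : Measurable fun ω => I.restrict fun n => X (w n) ω :=
    measurable_pi_lambda _ fun n => hXm _
  have hm2 : Measurable fun x => I.restrict fun n => w n x :=
    measurable_pi_lambda _ fun n => (w n).continuous.measurable
  -- Cramér–Wold: a functional of finitely many coordinates is, by linearity of `X`, the value of
  -- `X` at one combination of the `w i`, where the laws agree by `h`.
  refine Measure.ext_of_charFunDual (funext fun L => ?_)
  rw [charFunDual_eq_charFun_map_one, charFunDual_eq_charFun_map_one,
    Measure.map_map L.continuous.measurable hm1, Measure.map_map L.continuous.measurable hm2]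
  classical
  set c : I → ℝ := fun i => L (Pi.single i 1) with hc
  have hL : ∀ y : I → ℝ, L y = ∑ i, c i * y i := fun y => by
    conv_lhs => rw [pi_eq_sum_univ' y]
    simp [hc, mul_comm, Pi.single]
  have e1 : L ∘ (fun x => I.restrict fun n => w n x) = ⇑(∑ i, c i • w i) := by
    ext x
    simp [hL]
  have e2 : (L ∘ fun ω => I.restrict fun n => X (w n) ω) =ᵐ[P] X (∑ i, c i • w i) := by
    have h3 : ∀ᵐ ω ∂P, ∀ i : I, (c i • X (w i) : Lp ℝ 2 P) ω = c i * X (w i) ω :=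
      ae_all_iff.2 fun i => Lp.coeFn_smul (c i) (X (w i))
    filter_upwards [h3, Lp.coeFn_finsetSum Finset.univ fun i => (c i • X (w i) : Lp ℝ 2 P)]
      with ω h3 h4
    rw [map_sum]
    simp_rw [map_smul]
    rw [h4, Finset.sum_apply]
    simp [hL, h3]
  rw [e1, ← h, Measure.map_congr e2]

variable [CompleteSpace V] [TopologicalSpace.SeparableSpace V]

/-- The covariance operator `v ↦ ∫ v(x) x dμ` of a centred measure. -/
theorem exists_isCovarianceOperator {μ : Measure V} [IsGaussian μ]
    (h0 : ∀ v : StrongDual ℝ V, ∫ x, v x ∂μ = 0) :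
    ∃ R : StrongDual ℝ V →L[ℝ] V, IsCovarianceOperator μ R := by
  -- A Gaussian measure has a finite second moment, so this is a product of two `L²` functions; the
  -- same moment bounds the norm of `R`.
  have hint : ∀ v : StrongDual ℝ V, Integrable (fun x => v x • x) μ := fun v =>
    memLp_one_iff_integrable.1 ((IsGaussian.memLp_two_id (μ := μ)).smul
      (IsGaussian.memLp_dual μ v 2 (by simp)))
  have hint2 : Integrable (fun x : V => ‖x‖ ^ 2) μ :=
    (IsGaussian.memLp_two_id (μ := μ)).integrable_norm_pow two_ne_zero
  let R : StrongDual ℝ V →ₗ[ℝ] V :=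
    { toFun := fun v => ∫ x, v x • x ∂μ
      map_add' := fun v w => by
        rw [← integral_add (hint v) (hint w)]
        simp [add_smul]
      map_smul' := fun c v => by
        rw [RingHom.id_apply, ← integral_smul]
        simp [mul_smul] }
  refine ⟨R.mkContinuous (∫ x, ‖x‖ ^ 2 ∂μ) fun v => ?_, fun v w => ?_⟩
  · rw [mul_comm, ← integral_const_mul]
    refine norm_integral_le_of_norm_le (hint2.const_mul _) (ae_of_all _ fun x => ?_)
    rw [norm_smul, sq, ← mul_assoc]
    gcongr
    exact v.le_opNorm x
  · change w (∫ x, v x • x ∂μ) = _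
    rw [← w.integral_comp_comm (hint v), covariance, h0, h0]
    simp

/-- A linear family of random variables whose one-dimensional laws are those of a probability
measure on `V` is induced by a `V`-valued random variable. -/
theorem exists_isInducedBy_of_forall_map_eq {ν : Measure V} [IsProbabilityMeasure ν]
    (X : StrongDual ℝ V →ₗ[ℝ] Lp ℝ 2 P) (h : ∀ v, P.map (X v) = ν.map v) :
    ∃ Z : Ω → V, Measurable Z ∧ IsInducedBy P (fun v => (X v : Ω →ₘ[P] ℝ)) Z := by
  obtain ⟨d, hd⟩ := exists_seq_dual_separating V
  have hXm : ∀ v, Measurable (X v) := fun v => (Lp.stronglyMeasurable _).measurable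
  -- Lusin–Souslin: an injective Borel map from the Polish space `V` is a Borel embedding, so its
  -- inverse extends measurably to `ℝ^ℕ`.
  have hj : MeasurableEmbedding (fun (x : V) n => d n x) := by
    refine Measurable.measurableEmbedding
      (measurable_pi_lambda _ fun n => (d n).continuous.measurable) fun x y hxy => ?_
    refine sub_eq_zero.1 (hd _ fun n => ?_)
    rw [map_sub, sub_eq_zero]
    exact congrFun hxy n
  have hmX : Measurable fun ω n => X (d n) ω := measurable_pi_lambda _ fun n => hXm _
  refine ⟨fun ω => hj.invFun fun n => X (d n) ω, hj.measurable_invFun.comp hmX, fun v => ?_⟩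
  -- Putting `v` in front of `d` turns "coordinate zero equals `v` of the reconstructed point" into
  -- a Borel condition `S` on one sequence. It holds everywhere under `ν`, and equality of joint
  -- laws transfers it to `P`.
  let w : ℕ → StrongDual ℝ V := fun n => n.casesOn v d
  have hw := map_pi_eq_of_forall_map_eq X h w
  let S : Set (ℕ → ℝ) := {y | y 0 = v (hj.invFun fun n => y (n + 1))}
  have hS : MeasurableSet S := measurableSet_eq_fun (measurable_pi_apply 0)
    (v.continuous.measurable.comp (hj.measurable_invFun.comp
      (measurable_pi_lambda _ fun n => measurable_pi_apply (n + 1))))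
  have h1 : ∀ᵐ y ∂(ν.map (fun x n => w n x)), y ∈ S := by
    rw [ae_map_iff (p := (· ∈ S))
      (measurable_pi_lambda _ fun n => (w n).continuous.measurable).aemeasurable hS]
    refine ae_of_all _ fun x => ?_
    exact congrArg v (hj.leftInverse_invFun x).symm
  rw [← hw, ae_map_iff (p := (· ∈ S)) (measurable_pi_lambda _ fun n => hXm _).aemeasurable hS] at h1
  exact h1

/-- A linear family of centred Gaussian random variables is induced by a `V`-valued random variable
if and only if its variances are given by the covariance operator of a Gaussian measure. -/
theorem exists_isInducedBy_iff (X : StrongDual ℝ V →ₗ[ℝ] Lp ℝ 2 P)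
    (hX : ∀ v, HasLaw (X v) (gaussianReal 0 (‖X v‖₊ ^ 2)) P) :
    (∃ Z : Ω → V, Measurable Z ∧ IsInducedBy P (fun v => (X v : Ω →ₘ[P] ℝ)) Z) ↔
    ∃ (μ : Measure V) (R : StrongDual ℝ V →L[ℝ] V), IsGaussian μ ∧ IsCovarianceOperator μ R ∧
      ∀ v : StrongDual ℝ V, ‖X v‖ ^ 2 = v (R v) := by
  constructor
  · rintro ⟨Z, hZ, hXZ⟩
    have hmap := map_eq_gaussianReal_of_isInducedBy hX hZ hXZ
    have hG : IsGaussian (P.map Z) := isGaussian_of_map_eq_gaussianReal fun L => ⟨_, _, hmap L⟩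
    have hlaw : ∀ v : StrongDual ℝ V, HasLaw v (gaussianReal 0 (‖X v‖₊ ^ 2)) (P.map Z) :=
      fun v => ⟨v.continuous.measurable.aemeasurable, hmap v⟩
    obtain ⟨R, hR⟩ := exists_isCovarianceOperator (μ := P.map Z) fun v =>
      (hlaw v).integral_eq.trans integral_id_gaussianReal
    refine ⟨P.map Z, R, hG, hR, fun v => ?_⟩
    rw [hR v v, covariance_self v.continuous.measurable.aemeasurable, (hlaw v).variance_eq,
      variance_id_gaussianReal]
    simp
  · rintro ⟨μ, R, hG, hR, hvar⟩
    -- `μ` need not be centred, whereas the `X v` are; subtracting the mean keeps the covariance.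
    refine exists_isInducedBy_of_forall_map_eq (ν := μ.map (fun x => x - ∫ y, y ∂μ)) X fun v => ?_
    have hm : Measurable fun x : V => x - ∫ y, y ∂μ := measurable_id.sub_const _
    have hvm := v.continuous.measurable
    rw [(hX v).map_eq, IsGaussian.map_eq_gaussianReal v, integral_map hm.aemeasurable
      hvm.aestronglyMeasurable, variance_map hvm.aemeasurable hm.aemeasurable]
    have h1 : v ∘ (fun x : V => x - ∫ y, y ∂μ) = fun x => v x - v (∫ y, y ∂μ) := by
      ext x
      simp
    rw [h1, variance_sub_const hvm.aestronglyMeasurable, ← covariance_self hvm.aemeasurable, ← hR,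
      ← hvar]
    simp only [map_sub]
    rw [integral_sub (IsGaussian.integrable_dual μ v) (integrable_const _),
      IsGaussian.integral_dual]
    congr 1
    · simp
    · ext
      simp

end Induced

/-! ### The adjoint `i_Q*` and countability of orthonormal bases -/

section Reproducing

variable {U : Type*} [NormedAddCommGroup U] [NormedSpace ℝ U] [CompleteSpace U]
  {Q : PosSymmOperator U} {ι : Type*}

namespace PosSymmOperator

theorem continuous_inclAdj (Q : PosSymmOperator U) : Continuous Q.inclAdj := by
  unfold inclAdj
  fun_prop

theorem norm_inclAdj_le (Q : PosSymmOperator U) (u : StrongDual ℝ U) :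
    ‖Q.inclAdj u‖ ≤ ‖Q.incl‖ * ‖u‖ := by
  rw [inclAdj, LinearIsometryEquiv.norm_map, mul_comm]
  exact u.opNorm_comp_le Q.incl

theorem inner_inclAdj_inclAdj (Q : PosSymmOperator U) (u w : StrongDual ℝ U) :
    inner ℝ (Q.inclAdj u) (Q.inclAdj w) = w (Q.toCLM u) := by
  rw [Q.inner_inclAdj, Q.incl_inclAdj, Q.symm]

/-- Compare with a countable basis: every `e_k` is non-orthogonal to some element of it, and each
such element is non-orthogonal to only countably many `e_k`. Countability allows the sum over `k`
and the time integral to be interchanged. -/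
theorem Representation.countable [TopologicalSpace.SeparableSpace U] (r : Q.Representation ι) :
    Countable ι := by
  obtain ⟨s, ⟨r'⟩⟩ := Q.exists_representation
  have h : (Set.univ : Set ι) ⊆
      ⋃ n : s, Function.support fun k => inner ℝ (r'.basis n) (r.basis k)
        * inner ℝ (r.basis k) (r'.basis n) := by
    intro k _
    by_contra hk
    simp only [Set.mem_iUnion, Function.mem_support, not_exists, not_not] at hk
    have h := r'.basis.hasSum_inner_mul_inner (r.basis k) (r.basis k)
    simp_rw [mul_comm (inner ℝ (r.basis k) (r'.basis _)), hk] at h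
    have h0 := h.unique hasSum_zero
    rw [real_inner_self_eq_norm_sq, r.basis.orthonormal.1 k] at h0
    norm_num at h0
  exact Set.countable_univ_iff.1 ((Set.countable_iUnion fun n =>
    (r.basis.summable_inner_mul_inner (r'.basis n) (r'.basis n)).countable_support).mono h)

end PosSymmOperator

end Reproducing

/-! ### Square integrability of nonrandom integrands -/

section Integrand

variable {Ω : Type*} {mΩ : MeasurableSpace Ω} {P : Measure Ω} [IsProbabilityMeasure P]
  {𝓕 : Filtration ℝ≥0 mΩ}
  {U V : Type*} [NormedAddCommGroup U] [NormedSpace ℝ U]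
  [NormedAddCommGroup V] [NormedSpace ℝ V] {T : ℝ≥0} {Φ : ℝ → U →L[ℝ] V}

theorem IsIntegrand.memLp_comp (hΦ : IsIntegrand P 𝓕 T (fun s _ => Φ s)) (v : StrongDual ℝ V)
    {G : StrongDual ℝ U → ℝ} (hG : Continuous G) {C : ℝ} (hC : ∀ u, ‖G u‖ ≤ C * ‖u‖) :
    MemLp (fun s => G (v ∘L Φ s)) 2 (volume.restrict (Set.Icc (0 : ℝ) T)) := by
  -- Measurability is assumed on `[0, T] × Ω`; freezing any `ω` gives measurability in time.
  obtain ⟨ω⟩ : Nonempty Ω := P.nonempty_of_neZero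
  have hm : AEMeasurable (fun s => G (v ∘L Φ s)) (volume.restrict (Set.Icc (0 : ℝ) T)) := by
    refine aemeasurable_restrict_of_measurable_subtype measurableSet_Icc ?_
    let : MeasurableSpace (StrongDual ℝ U) := borel _
    have : BorelSpace (StrongDual ℝ U) := ⟨rfl⟩
    exact hG.measurable.comp ((hΦ.measurable v).comp (measurable_id.prodMk measurable_const :
      Measurable fun s : Set.Icc (0 : ℝ) T => (s, ω)))
  refine ⟨hm.aestronglyMeasurable, ?_⟩
  rw [eLpNorm_lt_top_iff_lintegral_rpow_enorm_lt_top (by simp) (by simp)]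
  have h := hΦ.lintegral_lt_top v
  simp only [lintegral_const, measure_univ, mul_one] at h
  have hb : ∀ s, ‖G (v ∘L Φ s)‖ₑ ^ (2 : ℝ≥0∞).toReal ≤ ENNReal.ofReal C ^ 2 * ‖v ∘L Φ s‖ₑ ^ 2 := by
    intro s
    rw [← mul_pow, ENNReal.toReal_ofNat, ENNReal.rpow_ofNat, ← ofReal_norm, ← ofReal_norm,
      ← ENNReal.ofReal_mul' (norm_nonneg _)]
    gcongr
    exact hC _
  refine (lintegral_mono hb).trans_lt ?_
  rw [lintegral_const_mul' _ _ (by simp)]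
  exact ENNReal.mul_lt_top (by simp) h

end Integrand

/-! ### The cylindrical integral: isometry, linearity, law -/

section CylindricalIntegral

variable {Ω : Type*} {mΩ : MeasurableSpace Ω} {P : Measure Ω} [IsProbabilityMeasure P]
  {𝓕 : Filtration ℝ≥0 mΩ}
  {U V : Type*} [NormedAddCommGroup U] [NormedSpace ℝ U] [CompleteSpace U]
  [NormedAddCommGroup V] [NormedSpace ℝ V]
  {W : ℝ≥0 → StrongDual ℝ U →ₗ[ℝ] (Ω →ₘ[P] ℝ)} {Q : PosSymmOperator U}
  {ι : Type*} {r : Q.Representation ι} {T : ℝ≥0} {Φ : ℝ → U →L[ℝ] V}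

theorem IsStronglyCylindricalWiener.isPreBrownianReal_dual
    (hW : IsStronglyCylindricalWiener P 𝓕 W Q) (r : Q.Representation ι) (k : ι) :
    IsPreBrownianReal (fun t => ⇑(W t (r.dual k))) P := by
  refine hW.isPreBrownianReal ?_
  rw [← Q.inner_inclAdj_inclAdj, r.inclAdj_dual, real_inner_self_eq_norm_sq,
    r.basis.orthonormal.1 k, one_pow]

theorem IsStronglyCylindricalWiener.inner_toLp_dual
    (hW : IsStronglyCylindricalWiener P 𝓕 W Q) (r : Q.Representation ι) {k l : ι} (hkl : k ≠ l)
    (s t : ℝ≥0) :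
    inner ℝ (((hW.isPreBrownianReal_dual r k).memLp_two s).toLp (W s (r.dual k)))
      (((hW.isPreBrownianReal_dual r l).memLp_two t).toLp (W t (r.dual l))) = 0 := by
  have h := hW.covariance_eq_min s t (r.dual k) (r.dual l)
  rw [← Q.inner_inclAdj_inclAdj, r.inclAdj_dual, r.inclAdj_dual, r.basis.orthonormal.2 hkl,
    mul_zero, covariance, hW.integral_eq_zero, hW.integral_eq_zero] at h
  refine Eq.trans ?_ h
  rw [L2.inner_def]
  refine integral_congr_ae ?_
  filter_upwards [((hW.isPreBrownianReal_dual r k).memLp_two s).coeFn_toLp,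
    ((hW.isPreBrownianReal_dual r l).memLp_two t).coeFn_toLp] with ω h1 h2
  rw [h1, h2]
  simp [mul_comm]

/-- The Wiener integral with respect to `Bₖ(t) = W(t) uₖ` as an isometry. -/
noncomputable def wienerIsometry (hW : IsStronglyCylindricalWiener P 𝓕 W Q)
    (r : Q.Representation ι) (T : ℝ≥0) (k : ι) :
    Lp ℝ 2 (volume.restrict (Set.Icc (0 : ℝ) T)) →ₗᵢ[ℝ] Lp ℝ 2 P where
  toLinearMap := (wienerIntegral (hW.isPreBrownianReal_dual r k) T).toLinearMap
  norm_map' := norm_wienerIntegral _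

theorem orthogonalFamily_wienerIsometry (hW : IsStronglyCylindricalWiener P 𝓕 W Q)
    (r : Q.Representation ι) (T : ℝ≥0) :
    OrthogonalFamily ℝ (fun _ => Lp ℝ 2 (volume.restrict (Set.Icc (0 : ℝ) T)))
      (wienerIsometry hW r T) := by
  -- Orthogonality to all `B_k(s)` passes to all integrals against `B_k`. Applying this in each
  -- argument reduces the claim to `B_k(s) ⟂ B_l(t)`.
  have key : ∀ k (Y : Lp ℝ 2 P), (∀ s, inner ℝ Y
      (((hW.isPreBrownianReal_dual r k).memLp_two s).toLp (W s (r.dual k))) = 0) →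
      ∀ f, inner ℝ Y (wienerIsometry hW r T k f) = 0 := fun k Y hY f => by
    have := wienerIntegral_mem (hW.isPreBrownianReal_dual r k) (K := (ℝ ∙ Y)ᗮ)
      (Submodule.isClosed_orthogonal _)
      (fun t => Submodule.mem_orthogonal_singleton_iff_inner_right.2 (hY t)) f
    exact Submodule.mem_orthogonal_singleton_iff_inner_right.1 this
  intro k l hkl f g
  refine key l _ (fun t => ?_) g
  rw [real_inner_comm]
  refine key k _ (fun s => ?_) f
  rw [real_inner_comm]
  exact hW.inner_toLp_dual r hkl s t

/-- The integrand `s ↦ ⟨Φ(s) i_Q eₖ, v⟩` in `L²([0, T])`. -/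
theorem IsIntegrand.memLp_coord (hΦ : IsIntegrand P 𝓕 T (fun s _ => Φ s)) (r : Q.Representation ι)
    (v : StrongDual ℝ V) (k : ι) :
    MemLp (fun s => v (Φ s (Q.incl (r.basis k)))) 2 (volume.restrict (Set.Icc (0 : ℝ) T)) :=
  hΦ.memLp_comp v (G := fun u => u (Q.incl (r.basis k))) (by fun_prop)
    (C := ‖Q.incl (r.basis k)‖) fun u => (u.le_opNorm _).trans (mul_comm _ _).le

theorem IsIntegrand.memLp_inclAdj (hΦ : IsIntegrand P 𝓕 T (fun s _ => Φ s)) (Q : PosSymmOperator U)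
    (v : StrongDual ℝ V) :
    MemLp (fun s => ‖Q.inclAdj (v ∘L Φ s)‖) 2 (volume.restrict (Set.Icc (0 : ℝ) T)) :=
  hΦ.memLp_comp v (G := fun u => ‖Q.inclAdj u‖) Q.continuous_inclAdj.norm
    (C := ‖Q.incl‖) fun u => by simpa using Q.norm_inclAdj_le u

theorem norm_toLp_sq {α : Type*} {mα : MeasurableSpace α} {μ : Measure α} {f : α → ℝ}
    (hf : MemLp f 2 μ) : ‖hf.toLp f‖ ^ 2 = ∫ x, f x ^ 2 ∂μ := by
  rw [← real_inner_self_eq_norm_sq, L2.inner_def]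
  refine integral_congr_ae ?_
  filter_upwards [hf.coeFn_toLp] with x hx
  simp [hx, sq]

/-- Parseval for the vector `i_Q* Φ*(s) v`, whose coordinates are `⟨Φ(s) i_Q e_k, v⟩`. -/
theorem hasSum_sq_coord (r : Q.Representation ι) (v : StrongDual ℝ V) (s : ℝ) :
    HasSum (fun k => v (Φ s (Q.incl (r.basis k))) ^ 2) (‖Q.inclAdj (v ∘L Φ s)‖ ^ 2) := by
  have h := r.basis.hasSum_inner_mul_inner (Q.inclAdj (v ∘L Φ s)) (Q.inclAdj (v ∘L Φ s))
  rw [real_inner_self_eq_norm_sq] at h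
  have h1 : (fun k => v (Φ s (Q.incl (r.basis k))) ^ 2) = fun k =>
      inner ℝ (Q.inclAdj (v ∘L Φ s)) (r.basis k) * inner ℝ (r.basis k) (Q.inclAdj (v ∘L Φ s)) := by
    ext k
    rw [real_inner_comm (Q.inclAdj _), Q.inner_inclAdj, sq]
    rfl
  rwa [h1]

theorem IsIntegrand.hasSum_norm_sq_coord [TopologicalSpace.SeparableSpace U]
    (hΦ : IsIntegrand P 𝓕 T (fun s _ => Φ s)) (r : Q.Representation ι) (v : StrongDual ℝ V) :
    HasSum (fun k => ‖(hΦ.memLp_coord r v k).toLp _‖ ^ 2)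
      (∫ s in Set.Icc (0 : ℝ) T, ‖Q.inclAdj (v ∘L Φ s)‖ ^ 2) := by
  have := r.countable
  simp_rw [norm_toLp_sq]
  have hint := fun k => (hΦ.memLp_coord r v k).integrable_sq
  have hs : Summable fun k => ∫ s in Set.Icc (0 : ℝ) T, v (Φ s (Q.incl (r.basis k))) ^ 2 := by
    refine summable_of_sum_le (c := ∫ s in Set.Icc (0 : ℝ) T, ‖Q.inclAdj (v ∘L Φ s)‖ ^ 2)
      (fun k => integral_nonneg fun s => sq_nonneg _) fun S => ?_
    rw [← integral_finsetSum _ fun k _ => hint k]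
    exact integral_mono (integrable_finsetSum _ fun k _ => hint k)
      (hΦ.memLp_inclAdj Q v).integrable_sq fun s =>
        sum_le_hasSum S (fun k _ => sq_nonneg _) (hasSum_sq_coord r v s)
  have h := hasSum_integral_of_summable_integral_norm hint (by simpa using hs)
  simpa [(hasSum_sq_coord r v _).tsum_eq] using h

theorem cylindricalIntegral_eq_tsum (hW : IsStronglyCylindricalWiener P 𝓕 W Q)
    (r : Q.Representation ι) (hΦ : IsIntegrand P 𝓕 T (fun s _ => Φ s)) (v : StrongDual ℝ V) :
    cylindricalIntegral P W r T (fun s _ => Φ s) v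
      = ∑' k, wienerIsometry hW r T k ((hΦ.memLp_coord r v k).toLp _) :=
  tsum_congr fun k =>
    itoIntegral_eq_wienerIntegral (hW.isPreBrownianReal_dual r k) (hΦ.memLp_coord r v k)

variable [TopologicalSpace.SeparableSpace U]

/-- The terms are pairwise orthogonal with summable squared norms, so the `tsum` in the definition
is a true limit and not the default value. -/
theorem hasSum_cylindricalIntegral (hW : IsStronglyCylindricalWiener P 𝓕 W Q)
    (r : Q.Representation ι) (hΦ : IsIntegrand P 𝓕 T (fun s _ => Φ s)) (v : StrongDual ℝ V) :
    HasSum (fun k => wienerIsometry hW r T k ((hΦ.memLp_coord r v k).toLp _))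
      (cylindricalIntegral P W r T (fun s _ => Φ s) v) := by
  rw [cylindricalIntegral_eq_tsum hW r hΦ v]
  exact ((orthogonalFamily_wienerIsometry hW r T).summable_iff_norm_sq_summable _).2
    (hΦ.hasSum_norm_sq_coord r v).summable |>.hasSum

/-- The Itô isometry for the cylindrical integral. -/
theorem norm_cylindricalIntegral_sq (hW : IsStronglyCylindricalWiener P 𝓕 W Q)
    (r : Q.Representation ι) (hΦ : IsIntegrand P 𝓕 T (fun s _ => Φ s)) (v : StrongDual ℝ V) :
    ‖cylindricalIntegral P W r T (fun s _ => Φ s) v‖ ^ 2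
      = ∫ s in Set.Icc (0 : ℝ) T, ‖Q.inclAdj (v ∘L Φ s)‖ ^ 2 := by
  have h := hasSum_cylindricalIntegral hW r hΦ v
  set X := cylindricalIntegral P W r T (fun s _ => Φ s) v
  -- Pairing the series with its own sum `X` gives `‖X‖²`; by orthogonality each term paired with
  -- `X` is its own squared norm.
  have h1 := h.mapL (innerSL ℝ X)
  refine HasSum.unique ?_ (hΦ.hasSum_norm_sq_coord r v)
  have h2 : ∀ k, innerSL ℝ X (wienerIsometry hW r T k ((hΦ.memLp_coord r v k).toLp _))
      = ‖(hΦ.memLp_coord r v k).toLp _‖ ^ 2 := fun k => by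
    set Y := wienerIsometry hW r T k ((hΦ.memLp_coord r v k).toLp _) with hY
    have h3 : inner ℝ Y X = inner ℝ Y Y := (h.mapL (innerSL ℝ Y)).unique
      (hasSum_single k fun l hl => orthogonalFamily_wienerIsometry hW r T hl.symm _ _)
    rw [innerSL_apply_apply, real_inner_comm, h3, real_inner_self_eq_norm_sq, hY,
      LinearIsometry.norm_map]
  simp_rw [h2, innerSL_apply_apply, real_inner_self_eq_norm_sq] at h1
  exact h1

/-- The cylindrical integral as a linear map. -/
noncomputable def cylindricalIntegralLinearMap (hW : IsStronglyCylindricalWiener P 𝓕 W Q)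
    (r : Q.Representation ι) (hΦ : IsIntegrand P 𝓕 T (fun s _ => Φ s)) :
    StrongDual ℝ V →ₗ[ℝ] Lp ℝ 2 P where
  toFun := cylindricalIntegral P W r T (fun s _ => Φ s)
  map_add' v w := by
    refine (hasSum_cylindricalIntegral hW r hΦ _).unique ?_
    convert (hasSum_cylindricalIntegral hW r hΦ v).add (hasSum_cylindricalIntegral hW r hΦ w)
      using 2 with k
    rw [← map_add, ← MemLp.toLp_add]
    rfl
  map_smul' c v := by
    refine (hasSum_cylindricalIntegral hW r hΦ _).unique ?_
    rw [RingHom.id_apply]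
    convert (hasSum_cylindricalIntegral hW r hΦ v).const_smul c using 2 with k
    rw [← map_smul, ← MemLp.toLp_const_smul]
    rfl

/-- Every partial sum lies in the closed span of the jointly Gaussian variables `W(t)u`, and so does
the limit. -/
theorem hasLaw_cylindricalIntegral (hW : IsStronglyCylindricalWiener P 𝓕 W Q)
    (r : Q.Representation ι) (hΦ : IsIntegrand P 𝓕 T (fun s _ => Φ s)) (v : StrongDual ℝ V) :
    HasLaw (cylindricalIntegral P W r T (fun s _ => Φ s) v)
      (gaussianReal 0 (‖cylindricalIntegral P W r T (fun s _ => Φ s) v‖₊ ^ 2)) P := by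
  let K := Submodule.span ℝ (Set.range fun p : ℝ≥0 × StrongDual ℝ U =>
    (hW.isGaussianProcess.hasGaussianLaw_eval p).memLp_two.toLp (W p.1 p.2))
  refine hasLaw_gaussianReal_of_mem_closure (S := K)
    (fun Y hY => hW.isGaussianProcess.hasLaw_of_mem_span
      (fun p => hW.integral_eq_zero p.1 p.2) hY) ?_
  rw [← Submodule.topologicalClosure_coe]
  refine K.isClosed_topologicalClosure.mem_of_tendsto (hasSum_cylindricalIntegral hW r hΦ v)
    (Eventually.of_forall fun S => Submodule.sum_mem _ fun k _ => ?_)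
  exact wienerIntegral_mem (hW.isPreBrownianReal_dual r k) K.isClosed_topologicalClosure
    (fun t => K.le_topologicalClosure (Submodule.subset_span ⟨(t, r.dual k), rfl⟩)) _

end CylindricalIntegral

theorem mainTheorem6 {Ω : Type*} {mΩ : MeasurableSpace Ω} (P : Measure Ω) [IsProbabilityMeasure P]
    (𝓕 : Filtration ℝ≥0 mΩ)
    {U : Type*} [NormedAddCommGroup U] [NormedSpace ℝ U] [CompleteSpace U]
    [TopologicalSpace.SeparableSpace U]
    {V : Type*} [NormedAddCommGroup V] [NormedSpace ℝ V] [CompleteSpace V]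
    [TopologicalSpace.SeparableSpace V] [MeasurableSpace V] [BorelSpace V]
    (W : ℝ≥0 → StrongDual ℝ U →ₗ[ℝ] (Ω →ₘ[P] ℝ)) (Q : PosSymmOperator U)
    (hW : IsStronglyCylindricalWiener P 𝓕 W Q)
    {ι : Type*} (r : Q.Representation ι) (T : ℝ≥0)
    (Φ : ℝ → U →L[ℝ] V) (hΦ : IsIntegrand P 𝓕 T (fun s _ => Φ s)) :
    (∃ Z : Ω → V, Measurable Z ∧
      IsInducedBy P (fun v => (cylindricalIntegral P W r T (fun s _ => Φ s) v : Ω →ₘ[P] ℝ)) Z) ↔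
    ∃ (μ : Measure V) (R : StrongDual ℝ V →L[ℝ] V), IsGaussian μ ∧ IsCovarianceOperator μ R ∧
      ∀ v : StrongDual ℝ V,
        ∫ s in Set.Icc (0 : ℝ) T, ‖Q.inclAdj (v ∘L Φ s)‖ ^ 2 = v (R v) := by

  simp_rw [← norm_cylindricalIntegral_sq hW r hΦ]
  exact exists_isInducedBy_iff (cylindricalIntegralLinearMap hW r hΦ)
    (hasLaw_cylindricalIntegral hW r hΦ)
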